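/- Let $d\ge 2$ and let $\mathbb E^d$ be the set of nearest-neighbour edges of $\mathbb Z^d$. A subgraph of $\mathbb Z^d$ is a set $X\subset\mathbb E^d$, identified with the graph $(\mathbb Z^d,X)$; it is called everywhere percolating if all its connected components are infinite, and it is said to percolate in $S\subset\mathbb Z^d$ if the graph induced by $X$ on $S$ has an infinite connected component. For $p\in[0,1]$, $p$-Bernoulli percolation on a subgraph $G$ is the random subset of $G$ obtained by keeping each edge of $G$ independently with probability $p$, and $p_c(G)$ is the infimum of all $p\in[0,1]$ for which it almost surely has an infinite connected component (with $p_c(G)=1$ if there is no such $p$). Write $\Lambda_r=[-r,r]^d\cap\mathbb Z^d$. Let $\varepsilon\in(0,1]$. There is an integer $L=L(\varepsilon,d)\ge 0$ such that, for every (deterministic) everywhere percolating subgraph $X$ of $\mathbb Z^d$, the random subgraph $Y=X\cup\omega$, with $\omega$ an $\varepsilon$-Bernoulli percolation on $\mathbb Z^d$, has the following properties. (i) $Y$ is connected almost surely. (ii) $p_c(Y)<1$ almost surely. (iii) $Y$ percolates in the upper half-space $\mathbb N\times\mathbb Z^{d-1}$ almost surely, where $\mathbb N=\{0,1,2,\ldots\}$.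 (iv) $Y$ percolates in the slab $\mathbb Z^2\times\{0,\ldots,L\}^{d-2}$ almost surely. (v) For every $p\in[0,1)$ there is an integer $n\ge 1$ such that $Y^{(n)}$ stochastically dominates $p$-Bernoulli percolation on $\mathbb Z^d$. Here $Y^{(n)}$ is the random subgraph of $\mathbb Z^d$ in which an edge $\{x,y\}\in\mathbb E^d$ is open if and only if $2nx$ is connected to $2ny$ by a path of $Y$ all of whose vertices lie in $n(x+y)+\Lambda_{2n}$. Stochastic domination means that every measurable increasing event has at least as large a probability for $Y^{(n)}$ as for $p$-Bernoulli percolation. -/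

import Mathlib

open MeasureTheory ProbabilityTheory

namespace LatticePerc

/-- The standard hypercubic lattice on `ℤ^d`: two points are adjacent when their `ℓ¹` distance
is one. -/
def lattice (d : ℕ) : SimpleGraph (Fin d → ℤ) where
  Adj x y := ∑ i, |x i - y i| = 1
  symm := ⟨fun x y h => by simpa only [abs_sub_comm] using h⟩
  loopless := ⟨fun x h => by simp at h⟩

/-- The set of edges of the lattice `ℤ^d`. -/
abbrev latticeEdges (d : ℕ) : Set (Sym2 (Fin d → ℤ)) := (lattice d).edgeSet

variable {d : ℕ}

/-- The graph `(ℤ^d, X)` given by a set of edges `X`; its vertex set is the whole of `ℤ^d`. -/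
abbrev graph (X : Set (Sym2 (Fin d → ℤ))) : SimpleGraph (Fin d → ℤ) :=
  SimpleGraph.fromEdgeSet X

/-- `X` is everywhere percolating: all connected components of `(ℤ^d, X)` are infinite. -/
def EverywherePercolating (X : Set (Sym2 (Fin d → ℤ))) : Prop :=
  ∀ C : (graph X).ConnectedComponent, C.supp.Infinite

/-- `X` percolates in `S`: the graph induced by `X` on `S` has an infinite connected component. -/
def PercolatesIn (X : Set (Sym2 (Fin d → ℤ))) (S : Set (Fin d → ℤ)) : Prop :=
  ∃ C : ((graph X).induce S).ConnectedComponent, C.supp.Infinite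

/-- `x` is `X`-connected to `y` inside `S`: some path of `X` from `x` to `y` has all its vertices
in `S`. -/
def ConnectedInside (X : Set (Sym2 (Fin d → ℤ))) (S : Set (Fin d → ℤ)) (x y : Fin d → ℤ) : Prop :=
  ∃ (hx : x ∈ S) (hy : y ∈ S), ((graph X).induce S).Reachable ⟨x, hx⟩ ⟨y, hy⟩

/-- The box `c + Λ_r`, with `Λ_r = [-r, r]^d ∩ ℤ^d`. -/
def box (c : Fin d → ℤ) (r : ℕ) : Set (Fin d → ℤ) :=
  {z | ∀ i, |z i - c i| ≤ (r : ℤ)}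

/-- The upper half-space `ℕ × ℤ^(d-1)`. -/
def halfSpace (d : ℕ) : Set (Fin d → ℤ) :=
  {z | ∀ i : Fin d, (i : ℕ) = 0 → 0 ≤ z i}

/-- The slab `ℤ^2 × {0, …, L}^(d-2)`. -/
def slab (d L : ℕ) : Set (Fin d → ℤ) :=
  {z | ∀ i : Fin d, 2 ≤ (i : ℕ) → 0 ≤ z i ∧ z i ≤ (L : ℤ)}

/-- The law of `p`-Bernoulli bond percolation on the graph `(ℤ^d, Y)`: every edge of `Y` is kept
independently with probability `p`. The `p`-Bernoulli percolation on `ℤ^d` itself is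
`bernoulliPerc (latticeEdges d) p`. -/
noncomputable abbrev bernoulliPerc (Y : Set (Sym2 (Fin d → ℤ))) (p : unitInterval) :
    Measure (Set (Sym2 (Fin d → ℤ))) :=
  setBernoulli Y p

/-- The critical parameter `p_c(Y)` of Bernoulli bond percolation on `(ℤ^d, Y)`: the infimum,
taken in the complete lattice `[0, 1]`, of all `p` such that `p`-Bernoulli percolation on `Y` has
an infinite connected component almost surely. (It is `1` if there is no such `p`.) -/
noncomputable def criticalParameter (Y : Set (Sym2 (Fin d → ℤ))) : unitInterval :=
  sInf {p : unitInterval | ∀ᵐ η ∂(bernoulliPerc Y p), PercolatesIn η Set.univ}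

/-- The renormalized configuration `Y^(n)`: the lattice edge `{x, y}` is open when `2nx` is
`Y`-connected to `2ny` inside `n(x + y) + Λ_{2n}`. -/
def renormalize (n : ℕ) (Y : Set (Sym2 (Fin d → ℤ))) : Set (Sym2 (Fin d → ℤ)) :=
  {e | ∃ x y : Fin d → ℤ, (lattice d).Adj x y ∧ e = s(x, y) ∧
    ConnectedInside Y (box ((n : ℤ) • (x + y)) (2 * n)) ((2 * n : ℤ) • x) ((2 * n : ℤ) • y)}

/-- The random set `Z`, defined on a space with probability measure `P`, stochastically dominates
a random set of law `ν`: every measurable increasing event has at least as large a probability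
for `Z` as under `ν`. -/
def StochasticallyDominates {Ω ι : Type*} [MeasurableSpace Ω] (P : Measure Ω) (Z : Ω → Set ι)
    (ν : Measure (Set ι)) : Prop :=
  ∀ A : Set (Set ι), MeasurableSet A → IsUpperSet A → ν A ≤ P (Z ⁻¹' A)

end LatticePerc

open LatticePerc

/-! Everything rests on local uniqueness (`exists_scale_locallyConnected`): at some scale `n`,
uniformly in `X` and in the location, with probability close to one all points of a box of radius
`n` are joined inside the concentric box of radius `2n`. To see it, add the random edges of the
spheres shell by shell, from radius `2n` inward to radius `n`, in `t` shells of `g` spheres each.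
Components of `X` are infinite, so every cluster meeting the inner box reaches every sphere of the
shell. If it does not cover the inner box, another cluster reaches the same spheres, and spheres are
connected when `d ≥ 2`; hence each sphere carries an edge leaving the cluster. These edges are
fresh, so all of them are closed with probability at most `(1 - ε) ^ g`. Otherwise the cluster
merges with another one and the minimal cluster size doubles. After `t` shells it would exceed the
number of points of the large box, so only covering is left. The union bound costs `t * 2 ^ t * (1 -
ε) ^ g`, which is small for `g = t ^ 2`, `n = t ^ 3`.

Local uniqueness around `n(x + y)` opens the renormalized edge `{x, y}`, and renormalized edges
depend on each other only at bounded distance, so the Liggett–Schonmann–Stacey theorem gives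
domination of Bernoulli percolation. At a fixed scale this survives an extra thinning `ζ` of
parameter `q < 1` close to one (`exists_scale_stochasticallyDominates`). For `p = 15/16`, a Peierls
argument in a quarter plane produces an infinite renormalized cluster, hence an infinite cluster of
`(X ∪ ω) ∩ ζ` in a thick quarter plane. This lies in the half-space and in a slab, and the thinning
yields `p_c < 1`. Connectedness comes directly from local uniqueness at growing scales. -/

namespace LatticePerc

/-! ### Bernoulli random sets: independence of coordinates and exploration. -/

section Bernoulli

variable {ι : Type*}

theorem setBernoulli_map_mem (u : Set ι) (p : unitInterval) (i : ι) :
    (setBernoulli u p).map (fun ω => i ∈ ω) =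
      unitInterval.toNNReal p • Measure.dirac (i ∈ u) +
        unitInterval.toNNReal (unitInterval.symm p) • Measure.dirac False := by
  rw [setBernoulli_eq_map, Measure.map_map (measurable_set_mem i) (by fun_prop)]
  exact Measure.infinitePi_map_eval _ i

/-- The coordinates of a Bernoulli random set are independent. -/
theorem iIndepFun_mem_setBernoulli (u : Set ι) (p : unitInterval) :
    iIndepFun (fun (i : ι) (ω : Set ι) => i ∈ ω) (setBernoulli u p) := by
  rw [iIndepFun_iff_map_fun_eq_infinitePi_map (fun i => measurable_set_mem i)]
  simp_rw [setBernoulli_map_mem]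
  rw [setBernoulli_eq_map, Measure.map_map (by fun_prop) (by fun_prop)]
  exact Measure.map_id

theorem setBernoulli_real_mem {u : Set ι} (p : unitInterval) {i : ι} (hi : i ∈ u) :
    (setBernoulli u p).real {ω | i ∈ ω} = p := by
  have h : (setBernoulli u p) {ω | i ∈ ω} = (setBernoulli u p).map (fun ω => i ∈ ω) {True} := by
    rw [Measure.map_apply (measurable_set_mem i) (measurableSet_singleton _)]
    congr 1; ext ω; simp
  rw [measureReal_def, h, setBernoulli_map_mem]
  simp [hi]

theorem measurableSet_mem_coord (i : ι) : MeasurableSet {ω : Set ι | i ∈ ω} :=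
  measurableSet_setOfPred.2 (measurable_set_mem i)

theorem setBernoulli_real_notMem {u : Set ι} (p : unitInterval) {i : ι} (hi : i ∈ u) :
    (setBernoulli u p).real {ω | i ∉ ω} = 1 - p := by
  have := probReal_compl_eq_one_sub (μ := setBernoulli u p) (measurableSet_mem_coord i)
  rw [setBernoulli_real_mem p hi] at this
  exact this

/-- Probability that a Bernoulli random set agrees with `z` on the finite set `S`. -/
theorem setBernoulli_real_cylinder {u : Set ι} (p : unitInterval) (S : Finset ι)
    (hS : ∀ i ∈ S, i ∈ u) (z : Set ι) [DecidablePred (· ∈ z)] :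
    (setBernoulli u p).real {ω | ∀ i ∈ S, (i ∈ ω ↔ i ∈ z)} =
      ∏ i ∈ S, if i ∈ z then (p : ℝ) else 1 - p := by
  have h := (iIndepFun_mem_setBernoulli u p).measure_inter_preimage_eq_mul S
    (sets := fun i => {i ∈ z}) (fun i _ => measurableSet_singleton _)
  have h2 : {ω : Set ι | ∀ i ∈ S, (i ∈ ω ↔ i ∈ z)} =
      ⋂ i ∈ S, (fun ω : Set ι => i ∈ ω) ⁻¹' {i ∈ z} := by
    ext ω; simp
  rw [measureReal_def, h2, h, ENNReal.toReal_prod]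
  refine Finset.prod_congr rfl fun i hi => ?_
  split_ifs with hz
  · rw [← setBernoulli_real_mem p (hS i hi), measureReal_def]
    congr 2; ext ω; simp [hz]
  · rw [← setBernoulli_real_notMem p (hS i hi), measureReal_def]
    congr 2; ext ω; simp [hz]

theorem setBernoulli_real_disjoint {u : Set ι} (p : unitInterval) (S : Finset ι)
    (hS : ∀ i ∈ S, i ∈ u) :
    (setBernoulli u p).real {ω | ∀ i ∈ S, i ∉ ω} = (1 - p : ℝ) ^ S.card := by
  classical
  have := setBernoulli_real_cylinder p S hS ∅
  simpa using this

/-- Bernoulli percolation on a subset is the trace of Bernoulli percolation. -/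
theorem setBernoulli_map_inter {u v : Set ι} (p : unitInterval) (h : v ⊆ u) :
    (setBernoulli u p).map (fun ω => v ∩ ω) = setBernoulli v p := by
  classical
  have hm : Measurable (fun ω : Set ι => v ∩ ω) := by
    refine measurable_set_iff.2 fun i => ?_
    by_cases hi : i ∈ v
    · simpa [hi] using measurable_set_mem i
    · simp [hi]
  have key := Measure.infinitePi_map_pi
    (μ := fun i : ι => unitInterval.toNNReal p • Measure.dirac (i ∈ u) +
      unitInterval.toNNReal (unitInterval.symm p) • Measure.dirac False)
    (f := fun i (a : Prop) => (i ∈ v ∧ a)) (fun i => Measurable.of_discrete)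
  have h2 : (fun i : ι => Measure.map (fun a : Prop => (i ∈ v ∧ a))
      (unitInterval.toNNReal p • Measure.dirac (i ∈ u) +
      unitInterval.toNNReal (unitInterval.symm p) • Measure.dirac False)) =
      fun i : ι => unitInterval.toNNReal p • Measure.dirac (i ∈ v) +
      unitInterval.toNNReal (unitInterval.symm p) • Measure.dirac False := by
    funext i
    rw [Measure.map_add _ _ Measurable.of_discrete, Measure.map_smul, Measure.map_smul,
      Measure.map_dirac' Measurable.of_discrete, Measure.map_dirac' Measurable.of_discrete]
    have : (i ∈ v ∧ i ∈ u) = (i ∈ v) := by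
      simp only [eq_iff_iff, and_iff_left_iff_imp]; exact fun hv => h hv
    simp [this]
  simp only [setBernoulli_eq_map]
  rw [Measure.map_map hm (by fun_prop)]
  conv_rhs => rw [← h2]
  rw [← key, Measure.map_map (by fun_prop) (by fun_prop)]
  rfl

/-- The function `f` of a pair of random sets only depends on their traces on `F`. -/
def DeterminedBy {β : Type*} (F : Set ι) (f : Set ι × Set ι → β) : Prop :=
  ∀ ω, f ω = f (ω.1 ∩ F, ω.2 ∩ F)

/-- Factoring through a finite discrete space makes measurability automatic and reduces independence
to that of finite traces. -/
theorem DeterminedBy.exists_comp {β : Type*} {F : Finset ι} {f : Set ι × Set ι → β}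
    (hf : DeterminedBy (F : Set ι) f) :
    ∃ φ : (F → Prop) × (F → Prop) → β,
      f = φ ∘ fun ω => ((fun e : F => (e : ι) ∈ ω.1), (fun e : F => (e : ι) ∈ ω.2)) := by
  refine ⟨fun c => f ({e | ∃ h : e ∈ F, c.1 ⟨e, h⟩}, {e | ∃ h : e ∈ F, c.2 ⟨e, h⟩}), ?_⟩
  funext ω
  rw [hf ω]
  simp only [Function.comp]
  congr 2 <;> · ext e; simp [and_comm]

theorem measurable_trace (F : Finset ι) :
    Measurable fun ω : Set ι => (fun e : F => (e : ι) ∈ ω) :=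
  measurable_pi_iff.2 fun _ => measurable_set_mem _

theorem DeterminedBy.measurable {β : Type*} [MeasurableSpace β] {F : Finset ι}
    {f : Set ι × Set ι → β} (hf : DeterminedBy (F : Set ι) f) : Measurable f := by
  obtain ⟨φ, rfl⟩ := hf.exists_comp
  exact (Measurable.of_discrete (f := φ)).comp
    (((measurable_trace F).comp measurable_fst).prodMk ((measurable_trace F).comp measurable_snd))

theorem indepFun_trace_setBernoulli (u : Set ι) (p : unitInterval) {F G : Finset ι}
    (h : Disjoint F G) :
    IndepFun (fun ω : Set ι => (fun e : F => (e : ι) ∈ ω)) (fun ω => (fun e : G => (e : ι) ∈ ω))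
      (setBernoulli u p) :=
  (iIndepFun_mem_setBernoulli u p).indepFun_finset F G h (fun i => measurable_set_mem i)

/-- Independent pairs on the two factors of a product space give an independent pair. -/
theorem IndepFun.prodMap {Ω Ω' α β α' β' : Type*} [MeasurableSpace Ω] [MeasurableSpace Ω']
    [MeasurableSpace α] [MeasurableSpace β] [MeasurableSpace α'] [MeasurableSpace β']
    [Finite α] [Finite β] [Finite α'] [Finite β']
    [MeasurableSingletonClass α] [MeasurableSingletonClass β]
    [MeasurableSingletonClass α'] [MeasurableSingletonClass β']
    {P : Measure Ω} {Q : Measure Ω'} [IsProbabilityMeasure P] [IsProbabilityMeasure Q]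
    {a : Ω → α} {b : Ω → β} {a' : Ω' → α'} {b' : Ω' → β'}
    (ha : Measurable a) (hb : Measurable b) (ha' : Measurable a') (hb' : Measurable b')
    (h : IndepFun a b P) (h' : IndepFun a' b' Q) :
    IndepFun (fun ω : Ω × Ω' => (a ω.1, a' ω.2)) (fun ω => (b ω.1, b' ω.2)) (P.prod Q) := by
  rw [indepFun_iff_map_prod_eq_prod_map_map (by fun_prop) (by fun_prop)]
  rw [Measure.ext_iff_singleton]
  rintro ⟨⟨x, x'⟩, ⟨y, y'⟩⟩
  have e1 : ({((x, x'), (y, y'))} : Set ((α × α') × (β × β'))) = {(x, x')} ×ˢ {(y, y')} := by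
    simp
  rw [Measure.map_apply (by fun_prop) (measurableSet_singleton _), e1, Measure.prod_prod,
    Measure.map_apply (by fun_prop) (measurableSet_singleton _),
    Measure.map_apply (by fun_prop) (measurableSet_singleton _)]
  have s1 : (fun ω : Ω × Ω' => ((a ω.1, a' ω.2), (b ω.1, b' ω.2))) ⁻¹' ({(x, x')} ×ˢ {(y, y')}) =
      (a ⁻¹' {x} ∩ b ⁻¹' {y}) ×ˢ (a' ⁻¹' {x'} ∩ b' ⁻¹' {y'}) := by
    ext; simp; tauto
  have s2 : (fun ω : Ω × Ω' => (a ω.1, a' ω.2)) ⁻¹' {(x, x')} =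
      (a ⁻¹' {x}) ×ˢ (a' ⁻¹' {x'}) := by
    ext; simp
  have s3 : (fun ω : Ω × Ω' => (b ω.1, b' ω.2)) ⁻¹' {(y, y')} =
      (b ⁻¹' {y}) ×ˢ (b' ⁻¹' {y'}) := by
    ext; simp
  rw [s1, s2, s3, Measure.prod_prod, Measure.prod_prod, Measure.prod_prod,
    h.measure_inter_preimage_eq_mul _ _ (measurableSet_singleton _) (measurableSet_singleton _),
    h'.measure_inter_preimage_eq_mul _ _ (measurableSet_singleton _) (measurableSet_singleton _)]
  ring

/-- Functions of a pair of independent Bernoulli random sets determined by disjoint finite sets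
of coordinates are independent. -/
theorem DeterminedBy.indepFun {β γ : Type*} [MeasurableSpace β] [MeasurableSpace γ]
    (u v : Set ι) (p q : unitInterval) {F G : Finset ι} (hFG : Disjoint F G)
    {f : Set ι × Set ι → β} {g : Set ι × Set ι → γ}
    (hf : DeterminedBy (F : Set ι) f) (hg : DeterminedBy (G : Set ι) g) :
    IndepFun f g ((setBernoulli u p).prod (setBernoulli v q)) := by
  obtain ⟨φ, rfl⟩ := hf.exists_comp
  obtain ⟨ψ, rfl⟩ := hg.exists_comp
  exact (IndepFun.prodMap (measurable_trace F) (measurable_trace G) (measurable_trace F)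
    (measurable_trace G) (indepFun_trace_setBernoulli u p hFG)
    (indepFun_trace_setBernoulli v q hFG)).comp Measurable.of_discrete Measurable.of_discrete

/-- A random family of coordinates, chosen according to the trace of the configuration on `F` and
avoiding `F`, is entirely closed with the expected probability. -/
theorem setBernoulli_real_closed_le [Countable ι] {u : Set ι} (p : unitInterval) (F : Finset ι)
    (Q : Set ι → Prop) (D : Set ι → Set ι) (g : ℕ)
    (h : ∀ η, Q η → ∃ K : Finset ι, (K : Set ι) ⊆ D η ∧ (K : Set ι) ⊆ u ∧ Disjoint F K ∧
      g ≤ K.card) :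
    (setBernoulli u p).real {ω | Q (ω ∩ F) ∧ ∀ e ∈ D (ω ∩ F), e ∉ ω} ≤ (1 - p : ℝ) ^ g := by
  classical
  have h0 : (0 : ℝ) ≤ 1 - p := by linarith [p.2.2]
  have h1 : (1 - p : ℝ) ≤ 1 := by linarith [p.2.1]
  -- Condition on the trace `z` on `F`: once `z` is fixed, `D z` is deterministic and contains at
  -- least `g` coordinates outside `F`, which are independent of the trace.
  let A : Finset ι → Set (Set ι) := fun z => {ω | ω ∩ F = z}
  have hA : ∀ z, A z = (fun ω : Set ι => (fun e : F => (e : ι) ∈ ω)) ⁻¹'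
      {c | ∀ ω : Set ι, (∀ e : F, c e ↔ (e : ι) ∈ ω) → ω ∩ F = z} := by
    intro z
    ext ω
    simp only [A, Set.mem_ofPred_eq, Set.mem_preimage]
    constructor
    · intro hω ω' h'
      rw [← hω]; ext e
      by_cases he : e ∈ F
      · simpa [he] using (h' ⟨e, he⟩).symm
      · simp [he]
    · intro hω; exact hω ω (fun _ => Iff.rfl)
  have hAm : ∀ z, MeasurableSet (A z) := fun z => by
    rw [hA]; exact measurable_trace F (MeasurableSet.of_discrete)
  have hsub : {ω | Q (ω ∩ F) ∧ ∀ e ∈ D (ω ∩ F), e ∉ ω} ⊆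
      ⋃ z ∈ F.powerset, A z ∩ {ω | Q z ∧ ∀ e ∈ D z, e ∉ ω} := by
    intro ω hω
    have e1 : ((F.filter (· ∈ ω) : Finset ι) : Set ι) = ω ∩ F := by ext; simp [and_comm]
    simp only [Set.mem_iUnion]
    refine ⟨F.filter (· ∈ ω), by simp, ?_, ?_⟩
    · simp [A, e1]
    · rw [e1]; exact hω
  have hone : ∀ z ∈ F.powerset, (setBernoulli u p).real (A z ∩ {ω | Q z ∧ ∀ e ∈ D z, e ∉ ω}) ≤
      (setBernoulli u p).real (A z) * (1 - p : ℝ) ^ g := by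
    intro z hz
    by_cases hQ : Q z
    · obtain ⟨K, hKD, hKu, hFK, hg⟩ := h _ hQ
      have hcl : {ω : Set ι | ∀ e ∈ K, e ∉ ω} = (fun ω : Set ι => (fun e : K => (e : ι) ∈ ω)) ⁻¹'
          {c | ∀ e, ¬ c e} := by
        ext ω; simp
      calc (setBernoulli u p).real (A z ∩ {ω | Q z ∧ ∀ e ∈ D z, e ∉ ω})
          ≤ (setBernoulli u p).real (A z ∩ {ω | ∀ e ∈ K, e ∉ ω}) :=
            measureReal_mono (fun ω hω => ⟨hω.1, fun e he => hω.2.2 e (hKD he)⟩)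
        _ = (setBernoulli u p).real (A z) * (setBernoulli u p).real {ω | ∀ e ∈ K, e ∉ ω} := by
            rw [hA, hcl, measureReal_def,
              (indepFun_trace_setBernoulli u p hFK).measure_inter_preimage_eq_mul _ _
              MeasurableSet.of_discrete MeasurableSet.of_discrete, ENNReal.toReal_mul]
            rfl
        _ ≤ _ := by
            rw [setBernoulli_real_disjoint p K (fun i hi => hKu hi)]
            exact mul_le_mul_of_nonneg_left (pow_le_pow_of_le_one h0 h1 hg) measureReal_nonneg
    · have : A z ∩ {ω | Q z ∧ ∀ e ∈ D z, e ∉ ω} = ∅ := by ext; simp [hQ]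
      rw [this]; simp only [measureReal_empty]
      positivity
  calc _ ≤ (setBernoulli u p).real
        (⋃ z ∈ F.powerset, A z ∩ {ω | Q z ∧ ∀ e ∈ D z, e ∉ ω}) := measureReal_mono hsub (measure_ne_top _ _)
    _ ≤ ∑ z ∈ F.powerset, (setBernoulli u p).real (A z ∩ {ω | Q z ∧ ∀ e ∈ D z, e ∉ ω}) :=
        measureReal_biUnion_finset_le _ _
    _ ≤ ∑ z ∈ F.powerset, (setBernoulli u p).real (A z) * (1 - p : ℝ) ^ g :=
        Finset.sum_le_sum hone
    _ = (setBernoulli u p).real (⋃ z ∈ F.powerset, A z) * (1 - p : ℝ) ^ g := by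
        rw [← Finset.sum_mul, measureReal_biUnion_finset]
        · intro z _ z' _ hzz'
          refine Set.disjoint_left.2 fun ω h1 h2 => hzz' ?_
          have : (z : Set ι) = z' := by rw [← show ω ∩ F = z from h1, ← show ω ∩ F = z' from h2]
          exact_mod_cast this
        · exact fun z _ => hAm z
    _ ≤ _ := by
        refine mul_le_of_le_one_left (by positivity) measureReal_le_one

end Bernoulli

/-! ### Finite-range dependent fields dominate product measures on finite sets. -/

section Domination

variable {Ω ι : Type*} [DecidableEq ι]

/-- The conditional weight, given `ω`, of the configuration `z` on `S` for the field `x` thinned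
independently with parameter `r`. -/
def thinWeight (x : ι → Ω → ℝ) (r : ℝ) (S z : Finset ι) (ω : Ω) : ℝ :=
  ∏ i ∈ S, if i ∈ z then r * x i ω else 1 - r * x i ω

variable {x : ι → Ω → ℝ} {r : ℝ}

theorem thinWeight_factor_mem (hx : ∀ i ω, x i ω = 0 ∨ x i ω = 1) (hr0 : 0 ≤ r) (hr1 : r ≤ 1)
    (z : Finset ι) (i : ι) (ω : Ω) :
    0 ≤ (if i ∈ z then r * x i ω else 1 - r * x i ω) ∧
      (if i ∈ z then r * x i ω else 1 - r * x i ω) ≤ if i ∈ z then r else 1 := by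
  rcases hx i ω with h | h <;> split_ifs <;> simp [h, hr0, hr1]

theorem thinWeight_nonneg (hx : ∀ i ω, x i ω = 0 ∨ x i ω = 1) (hr0 : 0 ≤ r) (hr1 : r ≤ 1)
    (S z : Finset ι) (ω : Ω) : 0 ≤ thinWeight x r S z ω :=
  Finset.prod_nonneg fun i _ => (thinWeight_factor_mem hx hr0 hr1 z i ω).1

theorem thinWeight_le (hx : ∀ i ω, x i ω = 0 ∨ x i ω = 1) (hr0 : 0 ≤ r) (hr1 : r ≤ 1)
    (S z : Finset ι) (ω : Ω) : thinWeight x r S z ω ≤ ∏ i ∈ S, if i ∈ z then r else 1 :=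
  Finset.prod_le_prod (fun i _ => (thinWeight_factor_mem hx hr0 hr1 z i ω).1)
    fun i _ => (thinWeight_factor_mem hx hr0 hr1 z i ω).2

theorem thinWeight_le_one (hx : ∀ i ω, x i ω = 0 ∨ x i ω = 1) (hr0 : 0 ≤ r) (hr1 : r ≤ 1)
    (S z : Finset ι) (ω : Ω) : thinWeight x r S z ω ≤ 1 :=
  Finset.prod_le_one (fun i _ => (thinWeight_factor_mem hx hr0 hr1 z i ω).1)
    fun i _ => (thinWeight_factor_mem hx hr0 hr1 z i ω).2.trans (by split_ifs <;> simp [hr1])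

theorem thinWeight_union {S T : Finset ι} (h : Disjoint S T) (z : Finset ι) (ω : Ω) :
    thinWeight x r (S ∪ T) z ω = thinWeight x r S z ω * thinWeight x r T z ω :=
  Finset.prod_union h

theorem thinWeight_insert {S : Finset ι} {i : ι} (h : i ∉ S) (z : Finset ι) (ω : Ω) :
    thinWeight x r (insert i S) z ω =
      (if i ∈ z then r * x i ω else 1 - r * x i ω) * thinWeight x r S z ω :=
  Finset.prod_insert h

theorem sum_powerset_insert_prod {S : Finset ι} {i : ι} (hi : i ∉ S)
    (a b : ι → ℝ) (f : Finset ι → ℝ) :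
    ∑ z ∈ (insert i S).powerset, (∏ j ∈ insert i S, if j ∈ z then a j else b j) * f z =
      ∑ z ∈ S.powerset, (∏ j ∈ S, if j ∈ z then a j else b j) *
        (a i * f (insert i z) + b i * f z) := by
  rw [Finset.sum_powerset_insert hi, ← Finset.sum_add_distrib]
  refine Finset.sum_congr rfl fun z hz => ?_
  have hiz : i ∉ z := fun h => hi (Finset.mem_powerset.1 hz h)
  rw [Finset.prod_insert hi, Finset.prod_insert hi]
  have : ∏ j ∈ S, (if j ∈ insert i z then a j else b j) = ∏ j ∈ S, if j ∈ z then a j else b j := by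
    refine Finset.prod_congr rfl fun j hj => ?_
    have : j ≠ i := fun h => hi (h ▸ hj)
    simp [this]
  rw [this]
  simp [hiz]
  ring

/-- Thinning only deletes points, so the mean of an increasing `f` over the thinned set is at most
its value at the full set of good sites. -/
theorem thinWeight_sum_le (hx : ∀ i ω, x i ω = 0 ∨ x i ω = 1) (hr0 : 0 ≤ r) (hr1 : r ≤ 1)
    (ω : Ω) [DecidablePred fun i => x i ω = 1] (S : Finset ι) (f : Finset ι → ℝ)
    (hf : Monotone f) :
    ∑ z ∈ S.powerset, thinWeight x r S z ω * f z ≤ f (S.filter fun i => x i ω = 1) := by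
  induction S using Finset.induction_on generalizing f with
  | empty => simp [thinWeight]
  | insert i S hi ih =>
    unfold thinWeight at ih ⊢
    rw [sum_powerset_insert_prod hi (fun j => r * x j ω) (fun j => 1 - r * x j ω)]
    rcases hx i ω with h | h
    · simp only [h, Finset.filter_insert]
      simpa using ih f hf
    · simp only [h, Finset.filter_insert]
      have hle := ih (fun z => f (insert i z)) (fun a b hab => hf (Finset.insert_subset_insert i hab))
      refine le_trans (Finset.sum_le_sum fun z _ => ?_) hle
      refine mul_le_mul_of_nonneg_left ?_ (thinWeight_nonneg hx hr0 hr1 S z ω)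
      have : f z ≤ f (insert i z) := hf (Finset.subset_insert i z)
      nlinarith

variable [MeasurableSpace Ω]

theorem measurable_thinWeight (hm : ∀ i, Measurable (x i)) (S z : Finset ι) :
    Measurable (thinWeight x r S z) := by
  unfold thinWeight
  refine Finset.measurable_prod _ fun i _ => ?_
  split_ifs
  · exact (hm i).const_mul r
  · exact measurable_const.sub ((hm i).const_mul r)

theorem integrable_of_mem_unit {P : Measure Ω} [IsFiniteMeasure P] {f : Ω → ℝ}
    (hf : Measurable f) (h0 : ∀ ω, 0 ≤ f ω) (h1 : ∀ ω, f ω ≤ 1) : Integrable f P :=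
  Integrable.of_bound hf.aestronglyMeasurable 1
    (Filter.Eventually.of_forall fun ω => by rw [Real.norm_of_nonneg (h0 ω)]; exact h1 ω)

theorem integrable_thinWeight {P : Measure Ω} [IsFiniteMeasure P] (hm : ∀ i, Measurable (x i))
    (hx : ∀ i ω, x i ω = 0 ∨ x i ω = 1) (hr0 : 0 ≤ r) (hr1 : r ≤ 1) (S z : Finset ι) :
    Integrable (thinWeight x r S z) P :=
  integrable_of_mem_unit (measurable_thinWeight hm S z) (thinWeight_nonneg hx hr0 hr1 S z)
    (thinWeight_le_one hx hr0 hr1 S z)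

theorem integrable_mul_thinWeight {P : Measure Ω} [IsFiniteMeasure P]
    (hm : ∀ i, Measurable (x i))
    (hx : ∀ i ω, x i ω = 0 ∨ x i ω = 1) (hr0 : 0 ≤ r) (hr1 : r ≤ 1) (S z : Finset ι) (i : ι) :
    Integrable (fun ω => x i ω * thinWeight x r S z ω) P := by
  refine integrable_of_mem_unit ((hm i).mul (measurable_thinWeight hm S z)) (fun ω => ?_)
    (fun ω => ?_)
  · have := thinWeight_nonneg hx hr0 hr1 S z ω
    rcases hx i ω with h | h <;> simp [h, this]
  · have := thinWeight_le_one hx hr0 hr1 S z ω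
    rcases hx i ω with h | h <;> simp [h, this]

theorem integral_one_sub_mul_thinWeight {P : Measure Ω} [IsFiniteMeasure P]
    (hm : ∀ i, Measurable (x i))
    (hx : ∀ i ω, x i ω = 0 ∨ x i ω = 1) (hr0 : 0 ≤ r) (hr1 : r ≤ 1) (S z : Finset ι) (i : ι) :
    ∫ ω, (1 - x i ω) * thinWeight x r S z ω ∂P =
      ∫ ω, thinWeight x r S z ω ∂P - ∫ ω, x i ω * thinWeight x r S z ω ∂P := by
  rw [← integral_sub (integrable_thinWeight hm hx hr0 hr1 S z)
    (integrable_mul_thinWeight hm hx hr0 hr1 S z i)]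
  congr 1; funext ω; ring

/-- The Liggett–Schonmann–Stacey estimate: conditionally on the values of the thinned field on a
finite set, every other site is bad with small probability. -/
theorem integral_bad_mul_thinWeight_le {P : Measure Ω} [IsProbabilityMeasure P]
    (hm : ∀ i, Measurable (x i)) (hx : ∀ i ω, x i ω = 0 ∨ x i ω = 1) (hr0 : 0 ≤ r) (hr1 : r ≤ 1)
    (Δ : ℕ) (hbad : ∀ i, ∫ ω, (1 - x i ω) ∂P ≤ (1 - r) * (r * (1 - r)) ^ Δ)
    (hind : ∀ i, ∃ N : Finset ι, N.card ≤ Δ ∧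
      ∀ M : Finset ι, Disjoint M N → IndepFun (x i) (fun ω (j : M) => x j ω) P)
    (z S : Finset ι) : ∀ i ∉ S,
    ∫ ω, (1 - x i ω) * thinWeight x r S z ω ∂P ≤ (1 - r) * ∫ ω, thinWeight x r S z ω ∂P := by
  induction S using Finset.strongInduction with
  | H S ih =>
  intro i hi
  obtain ⟨N, hN, hind⟩ := hind i
  -- The sites in `M` are independent of `i`; the at most `Δ` remaining sites `N'` are controlled
  -- crudely. The weight on `N'` is at most `W N'`, and including `N'` lowers the expected weight by
  -- at most the factor `c ^ N'.card * W N'`. The factor `W N'` cancels in the ratio, and `hbad`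
  -- absorbs the power of `c`.
  set M := S \ N with hM
  set N' := S ∩ N with hN'
  have hMN' : Disjoint M N' := Finset.disjoint_sdiff_inter S N
  have hS : M ∪ N' = S := Finset.sdiff_union_inter S N
  set c := r * (1 - r) with hc
  have hc0 : 0 ≤ c := mul_nonneg hr0 (by linarith)
  have hc1 : c ≤ 1 := by nlinarith
  have hcr : c ≤ 1 - r := by nlinarith
  set W : Finset ι → ℝ := fun K => ∏ j ∈ K, if j ∈ z then r else 1 with hW
  have hW0 : ∀ K, 0 ≤ W K := fun K => Finset.prod_nonneg fun j _ => by split_ifs <;> simp [hr0]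
  have hE0 : ∀ K, 0 ≤ ∫ ω, thinWeight x r K z ω ∂P := fun K =>
    integral_nonneg (thinWeight_nonneg hx hr0 hr1 K z)
  -- By the outer induction hypothesis a new site is good with conditional probability at least `r`,
  -- so after thinning it is open with probability at least `r * r` and closed with probability at
  -- least `1 - r`. Once the factor `r` recorded in `W` for open sites is taken out, at least `c = r
  -- * (1 - r)` remains in both cases.
  have lower : ∀ K ⊆ N', c ^ K.card * W K * ∫ ω, thinWeight x r M z ω ∂P ≤
      ∫ ω, thinWeight x r (M ∪ K) z ω ∂P := by
    intro K
    induction K using Finset.induction_on with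
    | empty => intro _; simp [hW]
    | insert j K hj ihK =>
      intro hK
      have hKN : K ⊆ N' := (Finset.subset_insert j K).trans hK
      have hjN : j ∈ N' := hK (Finset.mem_insert_self j K)
      have hjMK : j ∉ M ∪ K := by
        rw [Finset.mem_union, not_or]
        exact ⟨fun h => Finset.disjoint_left.1 hMN' h hjN, hj⟩
      have hss : M ∪ K ⊂ S := by
        refine (Finset.ssubset_iff_of_subset ?_).2 ⟨j, ?_, hjMK⟩
        · rw [← hS]; exact Finset.union_subset_union_right hKN
        · rw [← hS]; exact Finset.mem_union_right _ hjN
      have h1 := ih _ hss j hjMK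
      rw [integral_one_sub_mul_thinWeight hm hx hr0 hr1] at h1
      have h2 := ihK hKN
      rw [Finset.union_insert]
      have h3 : ∫ ω, thinWeight x r (insert j (M ∪ K)) z ω ∂P =
          if j ∈ z then r * ∫ ω, x j ω * thinWeight x r (M ∪ K) z ω ∂P
          else ∫ ω, thinWeight x r (M ∪ K) z ω ∂P
            - r * ∫ ω, x j ω * thinWeight x r (M ∪ K) z ω ∂P := by
        simp_rw [thinWeight_insert hjMK]
        split_ifs with hz
        · rw [← integral_const_mul]; congr 1; funext ω; ring
        · rw [← integral_const_mul, ← integral_sub (integrable_thinWeight hm hx hr0 hr1 _ z)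
            ((integrable_mul_thinWeight hm hx hr0 hr1 _ z j).const_mul r)]
          congr 1; funext ω; ring
      have hA : ∫ ω, x j ω * thinWeight x r (M ∪ K) z ω ∂P ≤
          ∫ ω, thinWeight x r (M ∪ K) z ω ∂P := by
        refine integral_mono (integrable_mul_thinWeight hm hx hr0 hr1 _ z j)
          (integrable_thinWeight hm hx hr0 hr1 _ z) fun ω => ?_
        have := thinWeight_nonneg hx hr0 hr1 (M ∪ K) z ω
        rcases hx j ω with h | h <;> simp [h, this]
      have hWi : W (insert j K) = (if j ∈ z then r else 1) * W K := Finset.prod_insert hj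
      rw [h3, Finset.card_insert_of_notMem hj, hWi, pow_succ]
      have hE := hE0 (M ∪ K)
      set a := ∫ ω, x j ω * thinWeight x r (M ∪ K) z ω ∂P
      set b := ∫ ω, thinWeight x r (M ∪ K) z ω ∂P
      set e := c ^ K.card * W K * ∫ ω, thinWeight x r M z ω ∂P with he
      split_ifs
      · have e1 : c ^ K.card * c * (r * W K) * ∫ ω, thinWeight x r M z ω ∂P = r * (c * e) := by
          rw [he]; ring
        rw [e1]
        refine mul_le_mul_of_nonneg_left ?_ hr0
        have : c ≤ r := by rw [hc]; nlinarith
        nlinarith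
      · have e1 : c ^ K.card * c * (1 * W K) * ∫ ω, thinWeight x r M z ω ∂P = c * e := by
          rw [he]; ring
        rw [e1]
        nlinarith
  have hindM : ∫ ω, (1 - x i ω) * thinWeight x r M z ω ∂P =
      (∫ ω, (1 - x i ω) ∂P) * ∫ ω, thinWeight x r M z ω ∂P := by
    have h1 : IndepFun (fun ω => 1 - x i ω) (thinWeight x r M z) P := by
      have h2 := (hind M Finset.sdiff_disjoint).comp
        (φ := fun t : ℝ => 1 - t)
        (ψ := fun y : M → ℝ => ∏ j : M, if (j : ι) ∈ z then r * y j else 1 - r * y j)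
        (by fun_prop) (Finset.measurable_prod _ fun j _ => by split_ifs <;> fun_prop)
      have h3 : thinWeight x r M z = (fun y : M → ℝ => ∏ j : M, if (j : ι) ∈ z then r * y j
          else 1 - r * y j) ∘ fun ω (j : M) => x j ω := by
        funext ω
        exact (Finset.prod_coe_sort M fun j => if j ∈ z then r * x j ω else 1 - r * x j ω).symm
      rw [h3]; exact h2
    exact h1.integral_fun_mul_eq_mul_integral
      (measurable_const.sub (hm i)).aestronglyMeasurable
      (measurable_thinWeight hm M z).aestronglyMeasurable
  have hx1 : ∀ ω, 0 ≤ 1 - x i ω ∧ 1 - x i ω ≤ 1 := fun ω => by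
    rcases hx i ω with h | h <;> simp [h]
  have hup : ∫ ω, (1 - x i ω) * thinWeight x r S z ω ∂P ≤
      W N' * ∫ ω, (1 - x i ω) * thinWeight x r M z ω ∂P := by
    rw [← integral_const_mul]
    have hmeas : ∀ K, Measurable fun ω => (1 - x i ω) * thinWeight x r K z ω := fun K =>
      (measurable_const.sub (hm i)).mul (measurable_thinWeight hm K z)
    have hint : ∀ K, Integrable (fun ω => (1 - x i ω) * thinWeight x r K z ω) P := fun K =>
      integrable_of_mem_unit (hmeas K)
        (fun ω => mul_nonneg (hx1 ω).1 (thinWeight_nonneg hx hr0 hr1 K z ω))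
        (fun ω => mul_le_one₀ (hx1 ω).2 (thinWeight_nonneg hx hr0 hr1 K z ω)
          (thinWeight_le_one hx hr0 hr1 K z ω))
    refine integral_mono (hint S) ((hint M).const_mul _) fun ω => ?_
    simp only
    rw [← hS, thinWeight_union hMN']
    have h1 := thinWeight_le hx hr0 hr1 N' z ω
    have h2 := mul_nonneg (hx1 ω).1 (thinWeight_nonneg hx hr0 hr1 M z ω)
    calc _ = ((1 - x i ω) * thinWeight x r M z ω) * thinWeight x r N' z ω := by ring
      _ ≤ ((1 - x i ω) * thinWeight x r M z ω) * W N' := mul_le_mul_of_nonneg_left h1 h2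
      _ = _ := by ring
  have hlow := lower N' le_rfl
  rw [hS] at hlow
  have hcard : N'.card ≤ Δ := (Finset.card_le_card Finset.inter_subset_right).trans hN
  have hpow : c ^ Δ ≤ c ^ N'.card := pow_le_pow_of_le_one hc0 hc1 hcard
  have hEM := hE0 M
  calc _ ≤ _ := hup
    _ = W N' * ((∫ ω, (1 - x i ω) ∂P) * ∫ ω, thinWeight x r M z ω ∂P) := by rw [hindM]
    _ ≤ W N' * (((1 - r) * c ^ N'.card) * ∫ ω, thinWeight x r M z ω ∂P) := by
        refine mul_le_mul_of_nonneg_left (mul_le_mul_of_nonneg_right ?_ hEM) (hW0 _)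
        exact (hbad i).trans (mul_le_mul_of_nonneg_left hpow (by linarith))
    _ = (1 - r) * (c ^ N'.card * W N' * ∫ ω, thinWeight x r M z ω ∂P) := by ring
    _ ≤ _ := mul_le_mul_of_nonneg_left hlow (by linarith)

/-- The expectation of `f` under the product Bernoulli measure on subsets of `S`. -/
def bernoulliSum (p : ℝ) (S : Finset ι) (f : Finset ι → ℝ) : ℝ :=
  ∑ z ∈ S.powerset, (∏ i ∈ S, if i ∈ z then p else 1 - p) * f z

/-- Reveal the thinned field site by site. By `hcl` each new site is good with conditional
probability at least `r`, hence open after thinning with probability at least `r ^ 2 ≥ p`, and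
raising this probability raises the mean of an increasing function. -/
theorem bernoulliSum_le {P : Measure Ω} [IsProbabilityMeasure P]
    (hm : ∀ i, Measurable (x i)) (hx : ∀ i ω, x i ω = 0 ∨ x i ω = 1) (hr0 : 0 ≤ r) (hr1 : r ≤ 1)
    (hcl : ∀ (z S : Finset ι), ∀ i ∉ S,
      ∫ ω, (1 - x i ω) * thinWeight x r S z ω ∂P ≤ (1 - r) * ∫ ω, thinWeight x r S z ω ∂P)
    {p : ℝ} (hp : p ≤ r ^ 2) (S : Finset ι) (f : Finset ι → ℝ) (hf : Monotone f)
    (hp0 : 0 ≤ p) (hp1 : p ≤ 1) :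
    bernoulliSum p S f ≤ ∑ z ∈ S.powerset, (∫ ω, thinWeight x r S z ω ∂P) * f z := by
  induction S using Finset.induction_on generalizing f with
  | empty => simp [thinWeight, bernoulliSum]
  | insert i S hi ih =>
    unfold bernoulliSum at ih ⊢
    rw [sum_powerset_insert_prod hi (fun _ => p) (fun _ => 1 - p)]
    have hmono : Monotone fun z => p * f (insert i z) + (1 - p) * f z := fun a b hab =>
      add_le_add (mul_le_mul_of_nonneg_left (hf (Finset.insert_subset_insert i hab)) hp0)
        (mul_le_mul_of_nonneg_left (hf hab) (by linarith))
    refine (ih _ hmono).trans ?_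
    rw [Finset.sum_powerset_insert hi, ← Finset.sum_add_distrib]
    refine Finset.sum_le_sum fun z hz => ?_
    have hiz : i ∉ z := fun h => hi (Finset.mem_powerset.1 hz h)
    have hI := integrable_thinWeight (P := P) hm hx hr0 hr1 S z
    have hI' := integrable_mul_thinWeight (P := P) hm hx hr0 hr1 S z i
    have e1 : ∫ ω, thinWeight x r (insert i S) z ω ∂P = ∫ ω, thinWeight x r S z ω ∂P
        - r * ∫ ω, x i ω * thinWeight x r S z ω ∂P := by
      simp_rw [thinWeight_insert hi]
      rw [← integral_const_mul, ← integral_sub hI (hI'.const_mul r)]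
      congr 1; funext ω; rw [if_neg hiz]; ring
    have e2 : ∫ ω, thinWeight x r (insert i S) (insert i z) ω ∂P =
        r * ∫ ω, x i ω * thinWeight x r S z ω ∂P := by
      simp_rw [thinWeight_insert hi]
      rw [← integral_const_mul]
      congr 1; funext ω
      rw [if_pos (Finset.mem_insert_self i z)]
      have : thinWeight x r S (insert i z) ω = thinWeight x r S z ω := by
        refine Finset.prod_congr rfl fun j hj => ?_
        have : j ≠ i := fun h => hi (h ▸ hj)
        simp [this]
      rw [this]; ring
    rw [e1, e2]
    have h1 := hcl z S i hi
    rw [integral_one_sub_mul_thinWeight hm hx hr0 hr1] at h1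
    have h0 : 0 ≤ ∫ ω, thinWeight x r S z ω ∂P := integral_nonneg (thinWeight_nonneg hx hr0 hr1 S z)
    set a := ∫ ω, x i ω * thinWeight x r S z ω ∂P
    set b := ∫ ω, thinWeight x r S z ω ∂P
    have hfz : f z ≤ f (insert i z) := hf (Finset.subset_insert i z)
    have hab : p * b ≤ r * a := by
      have : r * b ≤ a := by linarith
      nlinarith
    nlinarith [mul_nonneg (sub_nonneg.2 hab) (sub_nonneg.2 hfz)]

/-- A field with finite-range dependence and good marginals dominates a product measure on every
finite set of sites. -/
theorem bernoulliSum_le_integral {P : Measure Ω} [IsProbabilityMeasure P]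
    (hm : ∀ i, Measurable (x i)) (hx : ∀ i ω, x i ω = 0 ∨ x i ω = 1) (hr0 : 0 ≤ r) (hr1 : r ≤ 1)
    (Δ : ℕ) (hbad : ∀ i, ∫ ω, (1 - x i ω) ∂P ≤ (1 - r) * (r * (1 - r)) ^ Δ)
    (hind : ∀ i, ∃ N : Finset ι, N.card ≤ Δ ∧
      ∀ M : Finset ι, Disjoint M N → IndepFun (x i) (fun ω (j : M) => x j ω) P)
    {p : ℝ} (hp0 : 0 ≤ p) (hp1 : p ≤ 1) (hp : p ≤ r ^ 2) (S : Finset ι) (f : Finset ι → ℝ)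
    (hf : Monotone f) (g : Ω → ℝ) (hg : Integrable g P)
    (hfg : ∀ ω, ∀ T : Finset ι, (∀ i, i ∈ T ↔ i ∈ S ∧ x i ω = 1) → g ω = f T) :
    bernoulliSum p S f ≤ ∫ ω, g ω ∂P := by
  classical
  refine (bernoulliSum_le hm hx hr0 hr1
    (integral_bad_mul_thinWeight_le hm hx hr0 hr1 Δ hbad hind) hp S f hf hp0 hp1).trans ?_
  have hI := fun z => (integrable_thinWeight (P := P) hm hx hr0 hr1 S z).mul_const (f z)
  simp_rw [← integral_mul_const]
  rw [← integral_finsetSum _ fun z _ => hI z]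
  refine integral_mono (integrable_finsetSum _ fun z _ => hI z) hg fun ω => ?_
  rw [hfg ω (S.filter fun i => x i ω = 1) (fun i => by simp)]
  exact thinWeight_sum_le hx hr0 hr1 ω S f hf

end Domination

/-! ### From finitely many coordinates to all measurable increasing events. -/

section Compactness

variable {Ω ι : Type*} [MeasurableSpace Ω] [Countable ι]

theorem bernoulliSum_eq_integral [DecidableEq ι] {u : Set ι} (p : unitInterval) (S : Finset ι)
    (hS : ∀ i ∈ S, i ∈ u) (U : Set (Set ι)) [DecidablePred fun z : Finset ι => (z : Set ι) ∈ U] :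
    (setBernoulli u p).real {ω | ω ∩ S ∈ U} =
      bernoulliSum p S fun z => if (z : Set ι) ∈ U then 1 else 0 := by
  classical
  have e : {ω : Set ι | ω ∩ S ∈ U} = ⋃ z ∈ S.powerset.filter fun z : Finset ι => (z : Set ι) ∈ U,
      {ω | ∀ i ∈ S, (i ∈ ω ↔ i ∈ (z : Set ι))} := by
    ext ω
    simp only [Set.mem_ofPred_eq, Set.mem_iUnion, Finset.mem_filter, Finset.mem_powerset]
    constructor
    · intro h
      have e1 : ((S.filter (· ∈ ω) : Finset ι) : Set ι) = ω ∩ S := by ext; simp [and_comm]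
      exact ⟨S.filter (· ∈ ω), ⟨Finset.filter_subset _ _, by rwa [e1]⟩, fun i hi => by simp [hi]⟩
    · rintro ⟨z, ⟨hz, hzU⟩, h⟩
      convert hzU using 1
      ext i
      constructor
      · rintro ⟨h1, h2⟩; exact (h i h2).1 h1
      · intro hi; exact ⟨(h i (hz hi)).2 hi, hz hi⟩
  have hmeas : ∀ z : Finset ι, MeasurableSet {ω : Set ι | ∀ i ∈ S, (i ∈ ω ↔ i ∈ (z : Set ι))} := by
    intro z
    have : {ω : Set ι | ∀ i ∈ S, (i ∈ ω ↔ i ∈ (z : Set ι))} =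
        (fun ω : Set ι => (fun e : S => (e : ι) ∈ ω)) ⁻¹' {c | ∀ i : S, c i ↔ (i : ι) ∈ z} := by
      ext ω; simp
    rw [this]
    exact measurable_trace S MeasurableSet.of_discrete
  rw [e, measureReal_biUnion_finset]
  · rw [Finset.sum_filter, bernoulliSum]
    refine Finset.sum_congr rfl fun z _ => ?_
    rw [setBernoulli_real_cylinder p S hS]
    simp
  · intro z hz z' hz' hne
    simp only [Finset.coe_filter, Finset.mem_powerset, Set.mem_ofPred_eq] at hz hz'
    refine Set.disjoint_left.2 fun ω h1 h2 => hne ?_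
    ext i
    by_cases hi : i ∈ S
    · have := (h1 i hi).symm.trans (h2 i hi)
      simpa using this
    · exact ⟨fun h => absurd (hz.1 h) hi, fun h => absurd (hz'.1 h) hi⟩
  · exact fun z _ => hmeas z

/-- Domination of a Bernoulli random set can be checked on finite sets of coordinates. -/
theorem stochasticallyDominates_of_finite [DecidableEq ι] {P : Measure Ω} [IsProbabilityMeasure P]
    {Z : Ω → Set ι} (hZ : Measurable Z) {u : Set ι} (p : unitInterval)
    (h : ∀ S : Finset ι, (∀ i ∈ S, i ∈ u) → ∀ U : Set (Set ι), IsUpperSet U →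
      (setBernoulli u p).real {ω | ω ∩ S ∈ U} ≤ P.real {ω | Z ω ∩ S ∈ U}) :
    StochasticallyDominates P Z (setBernoulli u p) := by
  classical
  have hfin : ∀ S : Finset ι, ∀ U : Set (Set ι), IsUpperSet U →
      (setBernoulli u p) {ω | ω ∩ S ∈ U} ≤ P {ω | Z ω ∩ S ∈ U} := by
    intro S U hU
    have h1 := h (S.filter (· ∈ u)) (fun i hi => (Finset.mem_filter.1 hi).2) U hU
    rw [measureReal_def, measureReal_def,
      ENNReal.toReal_le_toReal (measure_ne_top _ _) (measure_ne_top _ _)] at h1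
    calc (setBernoulli u p) {ω | ω ∩ S ∈ U}
        ≤ (setBernoulli u p) {ω | ω ∩ (S.filter (· ∈ u) : Finset ι) ∈ U} := by
          refine measure_mono_ae ?_
          filter_upwards [setBernoulli_ae_subset (u := u) (p := p)] with ω hω hmem
          have : ω ∩ (S.filter (· ∈ u) : Finset ι) = ω ∩ S := by
            ext i; simp only [Set.mem_inter_iff, Finset.coe_filter, Set.mem_ofPred_eq, Finset.mem_coe]
            exact ⟨fun h => ⟨h.1, h.2.1⟩, fun h => ⟨h.1, h.2, hω h.1⟩⟩
          change ω ∩ (S.filter (· ∈ u) : Finset ι) ∈ U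
          rw [this]; exact hmem
      _ ≤ _ := h1
      _ ≤ _ := by
          refine measure_mono fun ω hω => hU ?_ hω
          exact Set.inter_subset_inter_right _ (by exact_mod_cast Finset.filter_subset _ _)
  intro A hA hup
  -- Transport to the compact space `ι → Bool`, where inner regularity allows the event to be
  -- replaced by a compact subset `K`.
  let b : (ι → Bool) → Set ι := fun c => {i | c i = true}
  let b' : Set ι → (ι → Bool) := fun ω i => decide (i ∈ ω)
  have hb : Measurable b := measurable_set_iff.2 fun i =>
    (Measurable.of_discrete (f := fun t : Bool => t = true)).comp (measurable_pi_apply i)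
  have hb' : Measurable b' := measurable_pi_iff.2 fun i =>
    (Measurable.of_discrete (f := fun t : Prop => decide t)).comp (measurable_set_mem i)
  have hbb : ∀ ω, b (b' ω) = ω := fun ω => by ext i; simp [b, b']
  set ν := (setBernoulli u p).map b' with hν
  have : IsProbabilityMeasure ν := Measure.isProbabilityMeasure_map hb'.aemeasurable
  have hνA : (setBernoulli u p) A = ν (b ⁻¹' A) := by
    rw [hν, Measure.map_apply hb' (hb hA), ← Set.preimage_comp]
    congr 1
    ext ω; simp [hbb]
  rw [hνA, (hb hA).measure_eq_iSup_isCompact]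
  refine iSup₂_le fun K hKA => iSup_le fun hK => ?_
  -- These increasing events depend on finitely many coordinates and decrease as `S` grows. By
  -- compactness of `K`, a configuration in all of them contains a single element of `K`, hence lies
  -- in `A`; continuity from above concludes.
  let C : Finset ι → Set (Set ι) := fun S => {ω | ∃ k ∈ K, ∀ i ∈ S, k i = true → i ∈ ω}
  have hCup : ∀ S, IsUpperSet (C S) := by
    rintro S ω ω' hωω' ⟨k, hk, hki⟩
    exact ⟨k, hk, fun i hi hi' => hωω' (hki i hi hi')⟩
  have hCS : ∀ S ω, ω ∩ (S : Set ι) ∈ C S ↔ ω ∈ C S := fun S ω =>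
    ⟨fun hω => hCup S Set.inter_subset_left hω,
      fun ⟨k, hk, hki⟩ => ⟨k, hk, fun i hi hi' => ⟨hki i hi hi', hi⟩⟩⟩
  have hCm : ∀ S, MeasurableSet (C S) := by
    intro S
    have : C S = (fun ω : Set ι => (fun e : S => (e : ι) ∈ ω)) ⁻¹'
        {c | ∃ k ∈ K, ∀ i : S, k i = true → c i} := by
      ext ω; simp [C]
    rw [this]
    exact measurable_trace S MeasurableSet.of_discrete
  have hle : ∀ S, ν K ≤ P (Z ⁻¹' C S) := by
    intro S
    calc ν K = (setBernoulli u p) (b' ⁻¹' K) := Measure.map_apply hb' hK.measurableSet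
      _ ≤ (setBernoulli u p) {ω | ω ∩ S ∈ C S} := by
          refine measure_mono fun ω hω => (hCS S ω).2 ⟨b' ω, hω, fun i _ hi => ?_⟩
          simpa [b'] using hi
      _ ≤ P {ω | Z ω ∩ S ∈ C S} := hfin S _ (hCup S)
      _ = P (Z ⁻¹' C S) := by
          congr 1; ext ω; exact hCS S (Z ω)
  have hanti : ∀ {S T : Finset ι}, S ⊆ T → C T ⊆ C S := fun hST ω ⟨k, hk, hki⟩ =>
    ⟨k, hk, fun i hi => hki i (hST hi)⟩
  have hinter : ⋂ S, C S ⊆ A := by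
    intro ω hω
    let F : Finset ι → Set (ι → Bool) := fun S => {k | ∀ i ∈ S, k i = true → i ∈ ω}
    have hFc : ∀ S, IsClosed (F S) := by
      intro S
      have : F S = ⋂ i ∈ S, (fun k : ι → Bool => k i) ⁻¹' {t | t = true → i ∈ ω} := by
        ext k; simp [F]
      rw [this]
      exact isClosed_biInter fun i _ => (isClosed_discrete _).preimage (continuous_apply i)
    obtain ⟨k, hkK, hk⟩ := hK.inter_iInter_nonempty F hFc (fun t => by
      obtain ⟨k, hk, hki⟩ := Set.mem_iInter.1 hω (t.biUnion id)
      refine ⟨k, hk, Set.mem_iInter₂.2 fun S hS i hi => hki i ?_⟩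
      exact Finset.mem_biUnion.2 ⟨S, hS, hi⟩)
    refine hup ?_ (hKA hkK)
    intro i hi
    exact (Set.mem_iInter.1 hk {i}) i (Finset.mem_singleton_self i) hi
  calc ν K ≤ ⨅ S, P (Z ⁻¹' C S) := le_iInf hle
    _ = P (⋂ S, Z ⁻¹' C S) := by
        rw [Directed.measure_iInter (fun S => (hZ (hCm S)).nullMeasurableSet)]
        · intro S T
          exact ⟨S ∪ T, Set.preimage_mono (hanti Finset.subset_union_left),
            Set.preimage_mono (hanti Finset.subset_union_right)⟩
        · exact ⟨∅, measure_ne_top _ _⟩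
    _ ≤ P (Z ⁻¹' A) := by
        refine measure_mono ?_
        rw [← Set.preimage_iInter]
        exact Set.preimage_mono hinter

end Compactness

/-- **Liggett–Schonmann–Stacey.** A random set with finite-range dependence whose points are
present with high probability dominates a Bernoulli random set. -/
theorem stochasticallyDominates_of_dependence {Ω ι : Type*} [MeasurableSpace Ω] [Countable ι]
    {P : Measure Ω} [IsProbabilityMeasure P] {Z : Ω → Set ι} (hZ : Measurable Z) {u : Set ι}
    (p : unitInterval) {r : ℝ} (hr0 : 0 ≤ r) (hr1 : r ≤ 1) (hp : p ≤ r ^ 2) (Δ : ℕ)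
    (hbad : ∀ i ∈ u, P.real {ω | i ∉ Z ω} ≤ (1 - r) * (r * (1 - r)) ^ Δ)
    (hind : ∀ i ∈ u, ∃ N : Finset ι, N.card ≤ Δ ∧ ∀ M : Finset ι, (∀ j ∈ M, j ∈ u) →
      Disjoint M N → IndepFun (fun ω => i ∈ Z ω) (fun ω (j : M) => (j : ι) ∈ Z ω) P) :
    StochasticallyDominates P Z (setBernoulli u p) := by
  classical
  refine stochasticallyDominates_of_finite hZ p fun S hS U hU => ?_
  rw [bernoulliSum_eq_integral p S hS U]
  -- the field on the sites of `u`
  let x : u → Ω → ℝ := fun i ω => if (i : ι) ∈ Z ω then 1 else 0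
  have hmi : ∀ i, MeasurableSet {ω | i ∈ Z ω} := fun i => hZ (measurableSet_mem_coord i)
  have hm : ∀ i, Measurable (x i) := fun i =>
    Measurable.ite (hmi i) measurable_const measurable_const
  have hx : ∀ i ω, x i ω = 0 ∨ x i ω = 1 := fun i ω => by
    by_cases h : (i : ι) ∈ Z ω <;> simp [x, h]
  let S' : Finset u := S.subtype (· ∈ u)
  have hS' : S'.map ⟨Subtype.val, Subtype.val_injective⟩ = S := by
    ext i; simp only [Finset.mem_map, Function.Embedding.coeFn_mk, S', Finset.mem_subtype]
    exact ⟨by rintro ⟨a, ha, rfl⟩; exact ha, fun hi => ⟨⟨i, hS i hi⟩, hi, rfl⟩⟩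
  let up : Finset u → Finset ι := fun z => z.map ⟨Subtype.val, Subtype.val_injective⟩
  let f : Finset ι → ℝ := fun z => if (z : Set ι) ∈ U then 1 else 0
  have hf : Monotone f := by
    intro a b hab
    simp only [f]
    split_ifs with h1 h2 h2
    · rfl
    · exact absurd (hU (by exact_mod_cast hab) h1) h2
    · exact zero_le_one
    · rfl
  have hsum : bernoulliSum (p : ℝ) S f = bernoulliSum (p : ℝ) S' (f ∘ up) := by
    unfold bernoulliSum
    symm
    refine Finset.sum_bij (fun z _ => up z) ?_ ?_ ?_ ?_
    · intro z hz
      rw [Finset.mem_powerset] at hz ⊢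
      rw [← hS']; exact Finset.map_subset_map.2 hz
    · intro a _ b _ hab; exact Finset.map_injective _ hab
    · intro b hb
      rw [Finset.mem_powerset] at hb
      refine ⟨b.subtype (· ∈ u), ?_, ?_⟩
      · rw [Finset.mem_powerset]
        intro i hi
        simp only [Finset.mem_subtype, S'] at hi ⊢
        exact hb hi
      · ext i; simp only [up, Finset.mem_map, Function.Embedding.coeFn_mk, Finset.mem_subtype]
        exact ⟨by rintro ⟨a, ha, rfl⟩; exact ha, fun hi => ⟨⟨i, hS i (hb hi)⟩, hi, rfl⟩⟩
    · intro z _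
      congr 1
      conv_rhs => rw [← hS']
      rw [Finset.prod_map]
      refine Finset.prod_congr rfl fun i _ => ?_
      simp [up]
  have hmU : MeasurableSet {ω | Z ω ∩ S ∈ U} := by
    have : {ω | Z ω ∩ S ∈ U} = Z ⁻¹' ((fun ω : Set ι => (fun e : S => (e : ι) ∈ ω)) ⁻¹'
        {c | {i | ∃ h : i ∈ S, c ⟨i, h⟩} ∈ U}) := by
      ext ω
      simp only [Set.mem_ofPred_eq, Set.mem_preimage]
      have : {i | ∃ _ : i ∈ S, i ∈ Z ω} = Z ω ∩ S := by ext; simp [and_comm]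
      rw [this]
    rw [this]
    exact hZ (measurable_trace S MeasurableSet.of_discrete)
  change bernoulliSum (p : ℝ) S f ≤ _
  rw [hsum, ← integral_indicator_one hmU]
  refine bernoulliSum_le_integral hm hx hr0 hr1 Δ ?_ ?_ p.2.1 p.2.2 hp S' _ ?_ _ ?_ ?_
  · intro i
    refine le_trans (le_of_eq ?_) (hbad i i.2)
    rw [show {ω | (i : ι) ∉ Z ω} = {ω | (i : ι) ∈ Z ω}ᶜ from rfl,
      ← integral_indicator_one (hmi i).compl]
    congr 1; funext ω
    by_cases h : (i : ι) ∈ Z ω <;> simp [x, h]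
  · intro i
    obtain ⟨N, hN, hNi⟩ := hind i i.2
    refine ⟨N.subtype (· ∈ u), ?_, fun M hM => ?_⟩
    · rw [Finset.card_subtype]; exact (Finset.card_filter_le _ _).trans hN
    · have h1 := hNi (up M) (by
        intro j hj; simp only [up, Finset.mem_map] at hj; obtain ⟨a, _, rfl⟩ := hj; exact a.2) (by
        rw [Finset.disjoint_left] at hM ⊢
        intro j hj hjN
        simp only [up, Finset.mem_map, Function.Embedding.coeFn_mk] at hj
        obtain ⟨a, ha, rfl⟩ := hj
        exact hM ha (by simpa using hjN))
      exact h1.comp (φ := fun t : Prop => if t then (1 : ℝ) else 0)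
        (ψ := fun (c : up M → Prop) (j : M) =>
          if c ⟨j, by simp [up]⟩ then (1 : ℝ) else 0) Measurable.of_discrete
        Measurable.of_discrete
  · exact fun a b hab => hf (Finset.map_subset_map.2 hab)
  · exact (integrable_const 1).indicator hmU
  · intro ω T hT
    have : ((up T : Finset ι) : Set ι) = Z ω ∩ S := by
      ext i
      simp only [up, Finset.coe_map, Function.Embedding.coeFn_mk, Set.mem_image, Finset.mem_coe,
        Set.mem_inter_iff]
      constructor
      · rintro ⟨a, ha, rfl⟩
        have := (hT a).1 ha
        refine ⟨?_, by simpa [S'] using this.1⟩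
        by_contra h
        simp [x, h] at this
      · rintro ⟨h1, h2⟩
        refine ⟨⟨i, hS i h2⟩, (hT _).2 ⟨by simpa [S'] using h2, by simp [x, h1]⟩, rfl⟩
    simp only [Function.comp, f, this, Set.indicator, Set.mem_ofPred_eq, Pi.one_apply]

/-! ### Calculus of connections inside a set. -/

section Connectivity

variable {d : ℕ} {X Y Y' : Set (Sym2 (Fin d → ℤ))} {S S' : Set (Fin d → ℤ)} {x y w : Fin d → ℤ}

theorem ConnectedInside.refl (hx : x ∈ S) : ConnectedInside Y S x x :=
  ⟨hx, hx, SimpleGraph.Reachable.refl _⟩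

theorem ConnectedInside.symm (h : ConnectedInside Y S x y) : ConnectedInside Y S y x := by
  obtain ⟨hx, hy, h⟩ := h
  exact ⟨hy, hx, h.symm⟩

theorem ConnectedInside.trans (h : ConnectedInside Y S x y) (h' : ConnectedInside Y S y w) :
    ConnectedInside Y S x w := by
  obtain ⟨hx, _, h⟩ := h
  obtain ⟨_, hw, h'⟩ := h'
  exact ⟨hx, hw, h.trans h'⟩

theorem ConnectedInside.of_edge (hx : x ∈ S) (hy : y ∈ S) (h : s(x, y) ∈ Y) :
    ConnectedInside Y S x y := by
  by_cases hxy : x = y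
  · subst hxy; exact .refl hx
  · refine ⟨hx, hy, SimpleGraph.Adj.reachable ?_⟩
    simp [SimpleGraph.fromEdgeSet_adj, h, hxy]

/-- Induction along a path. -/
theorem ConnectedInside.induct (h : ConnectedInside Y S x y) {p : (Fin d → ℤ) → Prop} (hx : p x)
    (hp : ∀ u v, u ∈ S → v ∈ S → s(u, v) ∈ Y → u ≠ v → p u → p v) : p y := by
  obtain ⟨hx', hy', h⟩ := h
  rw [SimpleGraph.reachable_iff_reflTransGen] at h
  have : ∀ b : S, Relation.ReflTransGen ((graph Y).induce S).Adj ⟨x, hx'⟩ b → p b := by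
    intro b hb
    induction hb with
    | refl => exact hx
    | tail _ hadj ih =>
      rw [SimpleGraph.comap_adj, SimpleGraph.fromEdgeSet_adj] at hadj
      exact hp _ _ (Subtype.prop _) (Subtype.prop _) hadj.1 hadj.2 ih
  exact this _ h

theorem ConnectedInside.mem_right (h : ConnectedInside Y S x y) : y ∈ S := h.2.1

theorem ConnectedInside.mono (hY : ∀ u v, u ∈ S → v ∈ S → s(u, v) ∈ Y → s(u, v) ∈ Y')
    (hS : S ⊆ S') (h : ConnectedInside Y S x y) : ConnectedInside Y' S' x y :=
  h.induct (p := fun y => ConnectedInside Y' S' x y) (.refl (hS h.1))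
    fun u v hu hv huv _ hxu => hxu.trans (.of_edge (hS hu) (hS hv) (hY u v hu hv huv))

end Connectivity

/-! ### Sup-norm balls, and connectedness of their spheres. -/

section Radius

variable {d : ℕ}

/-- The sup-norm distance from `z` to `x`. -/
def rad (z x : Fin d → ℤ) : ℕ := Finset.univ.sup fun i => (x i - z i).natAbs

theorem rad_le_iff {z x : Fin d → ℤ} {r : ℕ} : rad z x ≤ r ↔ ∀ i, (x i - z i).natAbs ≤ r := by
  simp [rad, Finset.sup_le_iff]

theorem mem_box_iff {z x : Fin d → ℤ} {r : ℕ} : x ∈ box z r ↔ rad z x ≤ r := by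
  rw [rad_le_iff]
  refine forall_congr' fun i => ?_
  rw [Int.abs_eq_natAbs]
  omega

theorem natAbs_le_rad (z x : Fin d → ℤ) (i : Fin d) : (x i - z i).natAbs ≤ rad z x :=
  rad_le_iff.1 le_rfl i

theorem abs_sub_le_one_of_adj {x y : Fin d → ℤ} (h : (lattice d).Adj x y) (i : Fin d) :
    |x i - y i| ≤ 1 := by
  have h' : ∑ i, |x i - y i| = 1 := h
  rw [← h']
  exact Finset.single_le_sum (f := fun i => |x i - y i|) (fun i _ => abs_nonneg _)
    (Finset.mem_univ i)

theorem rad_le_of_adj {x y : Fin d → ℤ} (z : Fin d → ℤ) (h : (lattice d).Adj x y) :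
    rad z y ≤ rad z x + 1 := by
  rw [rad_le_iff]
  intro i
  have h1 := natAbs_le_rad z x i
  have h2 := abs_sub_le_one_of_adj h i
  rw [abs_le] at h2
  omega

/-- The box as a finite set. -/
noncomputable def boxFinset (z : Fin d → ℤ) (r : ℕ) : Finset (Fin d → ℤ) :=
  Fintype.piFinset fun i => Finset.Icc (z i - r) (z i + r)

theorem coe_boxFinset (z : Fin d → ℤ) (r : ℕ) : (boxFinset z r : Set (Fin d → ℤ)) = box z r := by
  ext x
  simp only [boxFinset, Finset.mem_coe, Fintype.mem_piFinset, Finset.mem_Icc, box,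
    Set.mem_ofPred_eq, abs_le]
  refine forall_congr' fun i => ?_
  omega

theorem mem_boxFinset {z x : Fin d → ℤ} {r : ℕ} : x ∈ boxFinset z r ↔ x ∈ box z r := by
  rw [← coe_boxFinset, Finset.mem_coe]

theorem finite_box (z : Fin d → ℤ) (r : ℕ) : (box z r).Finite :=
  coe_boxFinset z r ▸ Finset.finite_toSet _

theorem card_boxFinset (z : Fin d → ℤ) (r : ℕ) : (boxFinset z r).card = (2 * r + 1) ^ d := by
  rw [boxFinset, Fintype.card_piFinset]
  simp only [Int.card_Icc]
  rw [Finset.prod_congr rfl fun i _ => show (z i + r + 1 - (z i - r)).toNat = 2 * r + 1 by omega]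
  simp

theorem box_mono (z : Fin d → ℤ) {r s : ℕ} (h : r ≤ s) : box z r ⊆ box z s := fun x hx => by
  rw [mem_box_iff] at hx ⊢; omega

theorem adj_update (x : Fin d → ℤ) (j : Fin d) (s : ℤ) :
    (lattice d).Adj (Function.update x j s) (Function.update x j (s + 1)) := by
  change ∑ i, |Function.update x j s i - Function.update x j (s + 1) i| = 1
  rw [Finset.sum_eq_single j]
  · simp
  · intro b _ hb; simp [hb]
  · simp

variable {z : Fin d → ℤ} {r : ℕ} {C : Set (Fin d → ℤ)}

/-- The coordinate `i` at extremal distance `r` keeps the point on the sphere while coordinate `j`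
moves by unit steps. -/
theorem mem_iff_update_mem
    (hC : ∀ u v, rad z u = r → rad z v = r → (lattice d).Adj u v → (u ∈ C ↔ v ∈ C))
    {x : Fin d → ℤ} (hx : rad z x = r) {i j : Fin d} (hi : (x i - z i).natAbs = r) (hij : j ≠ i)
    {t : ℤ} (ht : (t - z j).natAbs ≤ r) : x ∈ C ↔ Function.update x j t ∈ C := by
  have hrad : ∀ s : ℤ, (s - z j).natAbs ≤ r → rad z (Function.update x j s) = r := by
    intro s hs
    refine le_antisymm (rad_le_iff.2 fun k => ?_) ?_
    · by_cases hk : k = j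
      · subst hk; simpa using hs
      · simpa [hk] using hx ▸ natAbs_le_rad z x k
    · have := natAbs_le_rad z (Function.update x j s) i
      simpa [hij.symm, hi] using this
  have hmono : ∀ a b : ℤ, a ≤ b → (a - z j).natAbs ≤ r → (b - z j).natAbs ≤ r →
      (Function.update x j a ∈ C ↔ Function.update x j b ∈ C) := by
    intro a b hab ha
    induction b, hab using Int.leInduction with
    | base => intro _; rfl
    | succ b hab ih =>
      intro hb
      have hb' : (b - z j).natAbs ≤ r := by omega
      exact (ih hb').trans (hC _ _ (hrad b hb') (hrad _ hb) (adj_update x j b))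
  have hxj : (x j - z j).natAbs ≤ r := hx ▸ natAbs_le_rad z x j
  rw [← Function.update_eq_self j x, Function.update_idem]
  rcases le_total (x j) t with h | h
  · exact hmono _ _ h hxj ht
  · exact (hmono _ _ h ht hxj).symm

/-- All coordinates other than an extremal one `i` are moved to the corner. Some other coordinate
`j`, which exists because `d ≥ 2`, is then extremal, and this frees `i` to be moved as well. -/
theorem mem_iff_corner_mem
    (hC : ∀ u v, rad z u = r → rad z v = r → (lattice d).Adj u v → (u ∈ C ↔ v ∈ C))
    (hd : 2 ≤ d) {x : Fin d → ℤ} (hx : rad z x = r) :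
    x ∈ C ↔ (fun i => z i + (r : ℤ)) ∈ C := by
  have : Nontrivial (Fin d) := Fin.nontrivial_iff_two_le.2 hd
  obtain ⟨i, -, hi⟩ := Finset.exists_mem_eq_sup (Finset.univ : Finset (Fin d))
    Finset.univ_nonempty (fun i => (x i - z i).natAbs)
  replace hi : (x i - z i).natAbs = r := by rw [← hi]; exact hx
  obtain ⟨j, hji⟩ := exists_ne i
  have key : ∀ K : Finset (Fin d), i ∉ K →
      (x ∈ C ↔ (fun k => if k ∈ K then z k + (r : ℤ) else x k) ∈ C) ∧
        rad z (fun k => if k ∈ K then z k + (r : ℤ) else x k) = r := by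
    intro K
    induction K using Finset.induction_on with
    | empty => intro _; simpa using hx
    | insert k K hk ih =>
      intro hiK
      rw [Finset.mem_insert, not_or] at hiK
      obtain ⟨ih1, ih2⟩ := ih hiK.2
      have hupd : (fun l => if l ∈ insert k K then z l + (r : ℤ) else x l) =
          Function.update (fun l => if l ∈ K then z l + (r : ℤ) else x l) k (z k + r) := by
        funext l
        by_cases hl : l = k
        · subst hl; simp
        · simp [hl]
      refine ⟨ih1.trans ?_, ?_⟩
      · rw [hupd]
        exact mem_iff_update_mem hC ih2 (i := i) (by simp [hiK.2, hi]) (Ne.symm hiK.1) (by simp)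
      · refine le_antisymm (rad_le_iff.2 fun l => ?_) ?_
        · by_cases hl : l ∈ insert k K
          · simp [hl]
          · simpa [hl] using hx ▸ natAbs_le_rad z x l
        · have := natAbs_le_rad z (fun l => if l ∈ insert k K then z l + (r : ℤ) else x l) i
          simpa [hiK.1, hiK.2, hi] using this
  obtain ⟨h1, h2⟩ := key (Finset.univ.erase i) (by simp)
  rw [h1, mem_iff_update_mem hC h2 (i := j) (j := i) (t := z i + r) (by simp [hji]) hji.symm
    (by simp)]
  have : Function.update (fun k => if k ∈ Finset.univ.erase i then z k + (r : ℤ) else x k) i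
      (z i + r) = fun k => z k + (r : ℤ) := by
    funext k
    by_cases hk : k = i
    · subst hk; simp
    · simp [hk]
  rw [this]

/-- Sup-norm spheres of `ℤ^d` are connected for `d ≥ 2`. -/
theorem exists_edge_of_sphere (hd : 2 ≤ d) {x y : Fin d → ℤ} (hx : rad z x = r)
    (hy : rad z y = r) (hxC : x ∈ C) (hyC : y ∉ C) :
    ∃ u v, rad z u = r ∧ rad z v = r ∧ (lattice d).Adj u v ∧ u ∈ C ∧ v ∉ C := by
  by_contra! hno
  have hC : ∀ u v, rad z u = r → rad z v = r → (lattice d).Adj u v → (u ∈ C ↔ v ∈ C) :=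
    fun u v hu hv huv => ⟨hno u v hu hv huv, hno v u hv hu huv.symm⟩
  exact hyC ((mem_iff_corner_mem hC hd hy).2 ((mem_iff_corner_mem hC hd hx).1 hxC))

end Radius

/-! ### Cluster doubling and edges leaving a cluster. -/

section Clusters

variable {d : ℕ} {X Y Y' : Set (Sym2 (Fin d → ℤ))}

/-- The cluster of `x` in `(ℤ^d, Y)` restricted to the box of radius `R` around `z`. -/
def boxCluster (Y : Set (Sym2 (Fin d → ℤ))) (z : Fin d → ℤ) (R : ℕ) (x : Fin d → ℤ) :
    Set (Fin d → ℤ) :=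
  {y | ConnectedInside Y (box z R) x y}

/-- In an everywhere percolating graph, clusters cross all spheres around a box they meet. -/
theorem exists_connectedInside_rad_eq (hX : X ⊆ latticeEdges d) (hperc : EverywherePercolating X)
    {z x : Fin d → ℤ} {r R : ℕ} (hxr : rad z x ≤ r) (hrR : r ≤ R) :
    ∃ w, ConnectedInside X (box z R) x w ∧ rad z w = r := by
  by_contra! hno
  have hx : x ∈ box z R := mem_box_iff.2 (hxr.trans hrR)
  -- An edge changes the radius by at most one, so a cluster missing the sphere of radius `r` is
  -- trapped in the ball and its whole component is finite.
  let D : Set (Fin d → ℤ) := {w | ConnectedInside X (box z R) x w ∧ rad z w < r}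
  have hxD : x ∈ D := ⟨.refl hx, lt_of_le_of_ne hxr (hno x (.refl hx))⟩
  have hsub : ((graph X).connectedComponentMk x).supp ⊆ D := by
    intro y hy
    have hreach : (graph X).Reachable x y :=
      (SimpleGraph.ConnectedComponent.exact hy).symm
    rw [SimpleGraph.reachable_iff_reflTransGen] at hreach
    induction hreach with
    | refl => exact hxD
    | @tail b c hb hadj ih =>
      have hbD := ih (SimpleGraph.ConnectedComponent.sound
        ((SimpleGraph.reachable_iff_reflTransGen _ _).2 hb).symm)
      rw [SimpleGraph.fromEdgeSet_adj] at hadj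
      have hbc : (lattice d).Adj b c := hX hadj.1
      have h1 := rad_le_of_adj z hbc
      have h2 : rad z b < r := hbD.2
      have hc : c ∈ box z R := mem_box_iff.2 (by omega)
      have hxc : ConnectedInside X (box z R) x c :=
        hbD.1.trans (.of_edge hbD.1.mem_right hc hadj.1)
      exact ⟨hxc, lt_of_le_of_ne (by omega) (hno c hxc)⟩
  refine hperc ((graph X).connectedComponentMk x) ((finite_box z R).subset (hsub.trans ?_))
  exact fun w hw => hw.1.mem_right

/-- If every cluster of `Y` meeting the box of radius `b` is large, and every cluster meeting the
box of radius `a ≤ b` is joined in `Y'` to another one, then the clusters of `Y'` meeting the box of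
radius `a` are twice as large. -/
theorem boxCluster_doubling {z : Fin d → ℤ} {a b R k : ℕ} (hab : a ≤ b) (hbR : b ≤ R)
    (hY : Y ⊆ Y')
    (hbig : ∀ x ∈ box z b, box z b ⊆ boxCluster Y z R x ∨ k ≤ (boxCluster Y z R x).ncard)
    (hjoin : ∀ x ∈ box z a, box z a ⊆ boxCluster Y z R x ∨
      ∃ u v, u ∈ boxCluster Y z R x ∧ v ∈ box z b ∧ v ∉ boxCluster Y z R x ∧ s(u, v) ∈ Y') :
    ∀ x ∈ box z a, box z a ⊆ boxCluster Y' z R x ∨ 2 * k ≤ (boxCluster Y' z R x).ncard := by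
  intro x hx
  have hmono : ∀ {u v}, ConnectedInside Y (box z R) u v → ConnectedInside Y' (box z R) u v :=
    fun h => h.mono (fun _ _ _ _ h => hY h) le_rfl
  have hfin : ∀ (Z : Set (Sym2 (Fin d → ℤ))) w, (boxCluster Z z R w).Finite := fun Z w =>
    (finite_box z R).subset fun y hy => hy.mem_right
  rcases hjoin x hx with h | ⟨u, v, hu, hvb, hv, huv⟩
  · exact Or.inl fun y hy => hmono (h hy)
  · right
    have hxb : x ∈ box z b := box_mono z hab hx
    -- If the cluster of `x` or that of `v` covered the box of radius `b`, the two would coincide.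
    -- So both have at least `k` points, and being disjoint their sizes add.
    have h1 : k ≤ (boxCluster Y z R x).ncard :=
      (hbig x hxb).resolve_left fun h => hv (h hvb)
    have h2 : k ≤ (boxCluster Y z R v).ncard :=
      (hbig v hvb).resolve_left fun h => hv (ConnectedInside.symm (h hxb))
    have hdisj : Disjoint (boxCluster Y z R x) (boxCluster Y z R v) :=
      Set.disjoint_left.2 fun y hy hy' => hv (ConnectedInside.trans hy (ConnectedInside.symm hy'))
    have hsub : boxCluster Y z R x ∪ boxCluster Y z R v ⊆ boxCluster Y' z R x := by
      rintro y (hy | hy)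
      · exact hmono hy
      · exact ((hmono hu).trans (.of_edge hu.mem_right (box_mono z hbR hvb) huv)).trans (hmono hy)
    have := Set.ncard_le_ncard hsub (hfin _ _)
    rw [Set.ncard_union_eq hdisj (hfin _ _) (hfin _ _)] at this
    omega

/-- The lattice edges contained in the spheres of radius in `(a, b]` around `z`. -/
def shellEdges (z : Fin d → ℤ) (a b : ℕ) : Set (Sym2 (Fin d → ℤ)) :=
  {e | ∃ u v, (lattice d).Adj u v ∧ e = s(u, v) ∧ rad z u = rad z v ∧ a < rad z u ∧ rad z u ≤ b}

theorem finite_shellEdges (z : Fin d → ℤ) (a b : ℕ) : (shellEdges z a b).Finite := by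
  refine (((finite_box z b).prod (finite_box z b)).image fun p => s(p.1, p.2)).subset ?_
  rintro e ⟨u, v, _, rfl, h1, _, h3⟩
  exact ⟨(u, v), ⟨mem_box_iff.2 h3, mem_box_iff.2 (h1 ▸ h3)⟩, rfl⟩

theorem shellEdges_subset (z : Fin d → ℤ) (a b : ℕ) : shellEdges z a b ⊆ latticeEdges d := by
  rintro e ⟨u, v, h, rfl, _⟩; exact h

theorem shellEdges_mono (z : Fin d → ℤ) {a a' b b' : ℕ} (ha : a' ≤ a) (hb : b ≤ b') :
    shellEdges z a b ⊆ shellEdges z a' b' := by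
  rintro e ⟨u, v, h, rfl, h1, h2, h3⟩
  exact ⟨u, v, h, rfl, h1, by omega, by omega⟩

theorem disjoint_shellEdges (z : Fin d → ℤ) (a b c : ℕ) :
    Disjoint (shellEdges z b c) (shellEdges z a b) := by
  refine Set.disjoint_left.2 ?_
  rintro e ⟨u, v, _, rfl, h1, h2, _⟩ ⟨u', v', _, he, h3, _, h4⟩
  rw [Sym2.eq_iff] at he
  rcases he with ⟨rfl, rfl⟩ | ⟨rfl, rfl⟩ <;> omega

/-- The edges of the shell `(a, b]` leaving `C`. -/
def leavingEdges (z : Fin d → ℤ) (a b : ℕ) (C : Set (Fin d → ℤ)) : Set (Sym2 (Fin d → ℤ)) :=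
  {e | e ∈ shellEdges z a b ∧ ∃ u v, e = s(u, v) ∧ u ∈ C ∧ v ∉ C ∧ v ∈ box z b}

/-- A cluster meeting the inner box and not covering it has a leaving edge in every sphere. -/
theorem exists_leavingEdges (hd : 2 ≤ d) (hX : X ⊆ latticeEdges d)
    (hperc : EverywherePercolating X) (hXY : X ⊆ Y) {z x : Fin d → ℤ} {a b R : ℕ}
    (hbR : b ≤ R) (hx : x ∈ box z a) (hnot : ¬ box z a ⊆ boxCluster Y z R x) :
    ∃ K : Finset (Sym2 (Fin d → ℤ)), (K : Set _) ⊆ leavingEdges z a b (boxCluster Y z R x) ∧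
      K.card = b - a := by
  classical
  obtain ⟨y, hy, hyC⟩ := Set.not_subset.1 hnot
  rw [mem_box_iff] at hx hy
  have hedge : ∀ r : ℕ, ∃ e : Sym2 (Fin d → ℤ), a < r → r ≤ b →
      e ∈ leavingEdges z a b (boxCluster Y z R x) ∧ ∀ u ∈ e, rad z u = r := by
    intro r
    by_cases hr : a < r ∧ r ≤ b
    swap
    · exact ⟨s(x, x), fun h1 h2 => absurd ⟨h1, h2⟩ hr⟩
    obtain ⟨hr1, hr2⟩ := hr
    have hmono : ∀ {u v}, ConnectedInside X (box z R) u v → ConnectedInside Y (box z R) u v :=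
      fun h => h.mono (fun _ _ _ _ h => hXY h) le_rfl
    -- The points `x` and `y` lie in different clusters, and both reach the sphere of radius `r`
    -- through edges of `X` alone; connectedness of the sphere then provides an edge between the
    -- cluster of `x` and its complement.
    obtain ⟨x', hx', hx'r⟩ := exists_connectedInside_rad_eq hX hperc (hx.trans hr1.le)
      (hr2.trans hbR)
    obtain ⟨y', hy', hy'r⟩ := exists_connectedInside_rad_eq hX hperc (hy.trans hr1.le)
      (hr2.trans hbR)
    have hy'C : y' ∉ boxCluster Y z R x := fun h =>
      hyC (ConnectedInside.trans h (hmono hy').symm)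
    obtain ⟨u, v, hu, hv, huv, huC, hvC⟩ := exists_edge_of_sphere (C := boxCluster Y z R x) hd
      hx'r hy'r (hmono hx') hy'C
    refine ⟨s(u, v), fun _ _ => ⟨⟨⟨u, v, huv, rfl, by omega, by omega, by omega⟩, u, v, rfl, huC, hvC,
      mem_box_iff.2 (by omega)⟩, ?_⟩⟩
    intro w hw
    rcases Sym2.mem_iff.1 hw with rfl | rfl <;> assumption
  choose f hf using hedge
  refine ⟨(Finset.Ioc a b).image f, ?_, ?_⟩
  · intro e he
    simp only [Finset.coe_image, Set.mem_image, Finset.coe_Ioc, Set.mem_Ioc] at he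
    obtain ⟨r, ⟨h1, h2⟩, rfl⟩ := he
    exact (hf r h1 h2).1
  · rw [Finset.card_image_of_injOn, Nat.card_Ioc]
    intro r hr r' hr' hrr'
    simp only [Finset.coe_Ioc, Set.mem_Ioc] at hr hr'
    have hu := (hf r hr.1 hr.2).2
    have hu' := (hf r' hr'.1 hr'.2).2
    rw [← hrr'] at hu'
    obtain ⟨⟨u, v, _, he, _⟩, _⟩ := (hf r hr.1 hr.2).1
    have hmem : u ∈ f r := by rw [he]; simp
    rw [← hu u hmem, hu' u hmem]

end Clusters

/-! ### Local uniqueness with high probability. -/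

section LocalUniqueness

variable {d : ℕ} {X Y Y' : Set (Sym2 (Fin d → ℤ))}

/-- All points of the box of radius `n` are connected inside the box of radius `2n`. -/
def LocallyConnected (Y : Set (Sym2 (Fin d → ℤ))) (z : Fin d → ℤ) (n : ℕ) : Prop :=
  ∀ x ∈ box z n, ∀ y ∈ box z n, ConnectedInside Y (box z (2 * n)) x y

/-- Failure of a doubling step: the cluster of `x`, explored outside of the box of radius `b`, does
not cover the box of radius `a` and has no open leaving edge in the shell `(a, b]`. -/
def stuckEvent (X : Set (Sym2 (Fin d → ℤ))) (z : Fin d → ℤ) (a b R : ℕ) (x : Fin d → ℤ) :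
    Set (Set (Sym2 (Fin d → ℤ))) :=
  {ω | (¬ box z a ⊆ boxCluster (X ∪ (ω ∩ shellEdges z b R)) z R x) ∧
    ∀ e ∈ leavingEdges z a b (boxCluster (X ∪ (ω ∩ shellEdges z b R)) z R x), e ∉ ω}

/-- The explored cluster uses `ω` only on spheres of radius greater than `b`, while its leaving
edges lie on the `b - a` spheres of the shell, at least one on each: they are independent of the
exploration. -/
theorem setBernoulli_real_stuckEvent_le (hd : 2 ≤ d) (hX : X ⊆ latticeEdges d)
    (hperc : EverywherePercolating X) (ε : unitInterval) {z x : Fin d → ℤ} {a b R : ℕ}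
    (hbR : b ≤ R) (hx : x ∈ box z a) :
    (setBernoulli (latticeEdges d) ε).real (stuckEvent X z a b R x) ≤ (1 - ε : ℝ) ^ (b - a) := by
  have h := setBernoulli_real_closed_le (u := latticeEdges d) ε
    (finite_shellEdges z b R).toFinset
    (fun η => ¬ box z a ⊆ boxCluster (X ∪ η) z R x)
    (fun η => leavingEdges z a b (boxCluster (X ∪ η) z R x)) (b - a) (fun η hη => by
      obtain ⟨K, hK, hcard⟩ := exists_leavingEdges hd hX hperc
        (Set.subset_union_left (t := η)) hbR hx hη
      refine ⟨K, hK, fun e he => shellEdges_subset z a b (hK he).1, ?_, hcard.ge⟩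
      rw [Finset.disjoint_left]
      intro e he heK
      exact Set.disjoint_left.1 (disjoint_shellEdges z a b R) (by simpa using he) (hK heK).1)
  simpa [stuckEvent] using h

/-- Iterated doubling: after `i` shells the radius is `2n - i * g`, and each cluster meeting that
box covers it or has at least `2 ^ i` points. At `i = t` the radius is `n`, and the second
alternative is impossible because the box of radius `2n` has only `(4n + 1) ^ d` points. -/
theorem locallyConnected_of_not_stuck {z : Fin d → ℤ} {t g n : ℕ}
    (hn : n = t * g) (ht : (4 * n + 1) ^ d < 2 ^ t) {ω : Set (Sym2 (Fin d → ℤ))}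
    (h : ∀ i < t, ∀ x ∈ box z (2 * n - (i + 1) * g),
      ω ∉ stuckEvent X z (2 * n - (i + 1) * g) (2 * n - i * g) (2 * n) x) :
    LocallyConnected (X ∪ ω) z n := by
  have hbig : ∀ i ≤ t, ∀ x ∈ box z (2 * n - i * g),
      box z (2 * n - i * g) ⊆
        boxCluster (X ∪ (ω ∩ shellEdges z (2 * n - i * g) (2 * n))) z (2 * n) x ∨
      2 ^ i ≤ (boxCluster (X ∪ (ω ∩ shellEdges z (2 * n - i * g) (2 * n))) z (2 * n) x).ncard := by
    intro i
    induction i with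
    | zero =>
      intro _ x hx
      right
      exact (pow_zero 2).trans_le ((Set.ncard_pos
        ((finite_box z (2 * n)).subset fun y hy => ConnectedInside.mem_right hy)).2
        ⟨x, ConnectedInside.refl (by simpa using hx)⟩)
    | succ i ih =>
      intro hi
      have hle : 2 * n - (i + 1) * g ≤ 2 * n - i * g :=
        Nat.sub_le_sub_left (Nat.mul_le_mul_right _ (Nat.le_succ i)) _
      rw [pow_succ, mul_comm _ 2]
      refine boxCluster_doubling hle (Nat.sub_le _ _) ?_ (ih (by omega)) ?_
      · exact Set.union_subset_union_right _
          (Set.inter_subset_inter_right _ (shellEdges_mono z hle le_rfl))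
      · intro x hx
        by_cases hcov : box z (2 * n - (i + 1) * g) ⊆
          boxCluster (X ∪ (ω ∩ shellEdges z (2 * n - i * g) (2 * n))) z (2 * n) x
        · exact Or.inl hcov
        · right
          have hns := h i (by omega) x hx
          simp only [stuckEvent, Set.mem_ofPred_eq, not_and, not_forall, not_not] at hns
          obtain ⟨e, ⟨hsh, u, v, rfl, hu, hv, hvb⟩, heω⟩ := hns hcov
          exact ⟨u, v, hu, hvb, hv, Or.inr ⟨heω, shellEdges_mono z le_rfl (Nat.sub_le _ _) hsh⟩⟩
  have hR : 2 * n - t * g = n := by omega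
  intro x hx y hy
  have hsub : X ∪ (ω ∩ shellEdges z (2 * n - t * g) (2 * n)) ⊆ X ∪ ω :=
    Set.union_subset_union_right _ Set.inter_subset_left
  rcases hbig t le_rfl x (by rwa [hR]) with hc | hc
  · exact (hc (by rwa [hR])).mono (fun _ _ _ _ h => hsub h) le_rfl
  · exfalso
    have h1 := Set.ncard_le_ncard (fun y (hy : y ∈ boxCluster
      (X ∪ (ω ∩ shellEdges z (2 * n - t * g) (2 * n))) z (2 * n) x) =>
        ConnectedInside.mem_right hy) (finite_box z (2 * n))
    rw [← coe_boxFinset, Set.ncard_coe_finset, card_boxFinset] at h1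
    have : 2 * (2 * n) + 1 = 4 * n + 1 := by ring
    rw [this] at h1
    omega

/-- Union bound over the `t` shells and over the starting points, of which there are at most `(4n +
1) ^ d < 2 ^ t` per shell. -/
theorem setBernoulli_real_not_locallyConnected_le (hd : 2 ≤ d) (hX : X ⊆ latticeEdges d)
    (hperc : EverywherePercolating X) (ε : unitInterval) (z : Fin d → ℤ) {t g n : ℕ}
    (hn : n = t * g) (ht : (4 * n + 1) ^ d < 2 ^ t) :
    (setBernoulli (latticeEdges d) ε).real {ω | ¬ LocallyConnected (X ∪ ω) z n} ≤
      t * 2 ^ t * (1 - ε : ℝ) ^ g := by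
  have h0 : (0 : ℝ) ≤ 1 - ε := by linarith [ε.2.2]
  let s : ℕ → Finset (Fin d → ℤ) := fun i => boxFinset z (2 * n - (i + 1) * g)
  let B : ℕ → (Fin d → ℤ) → Set (Set (Sym2 (Fin d → ℤ))) := fun i x =>
    stuckEvent X z (2 * n - (i + 1) * g) (2 * n - i * g) (2 * n) x
  have hsub : {ω | ¬ LocallyConnected (X ∪ ω) z n} ⊆
      ⋃ i ∈ Finset.range t, ⋃ x ∈ s i, B i x := by
    intro ω hω
    by_contra hno
    refine hω (locallyConnected_of_not_stuck hn ht fun i hi x hx hmem => hno ?_)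
    simp only [Set.mem_iUnion]
    exact ⟨i, Finset.mem_range.2 hi, x, mem_boxFinset.2 hx, hmem⟩
  calc _ ≤ (setBernoulli (latticeEdges d) ε).real (⋃ i ∈ Finset.range t, ⋃ x ∈ s i, B i x) :=
        measureReal_mono hsub (measure_ne_top _ _)
    _ ≤ ∑ i ∈ Finset.range t, (setBernoulli (latticeEdges d) ε).real (⋃ x ∈ s i, B i x) :=
        measureReal_biUnion_finset_le _ _
    _ ≤ ∑ i ∈ Finset.range t, ∑ x ∈ s i, (setBernoulli (latticeEdges d) ε).real (B i x) :=
        Finset.sum_le_sum fun i _ => measureReal_biUnion_finset_le _ _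
    _ ≤ ∑ i ∈ Finset.range t, ∑ x ∈ s i, (1 - ε : ℝ) ^ g := by
        refine Finset.sum_le_sum fun i hi => Finset.sum_le_sum fun x hx => ?_
        refine (setBernoulli_real_stuckEvent_le hd hX hperc ε (Nat.sub_le _ _)
          (mem_boxFinset.1 hx)).trans (le_of_eq ?_)
        congr 1
        have h1 : (i + 1) * g ≤ n := hn ▸ Nat.mul_le_mul_right _ (Finset.mem_range.1 hi)
        have h2 : (i + 1) * g = i * g + g := by ring
        omega
    _ ≤ ∑ i ∈ Finset.range t, (2 ^ t : ℝ) * (1 - ε : ℝ) ^ g := by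
        refine Finset.sum_le_sum fun i _ => ?_
        rw [Finset.sum_const, nsmul_eq_mul]
        refine mul_le_mul_of_nonneg_right ?_ (by positivity)
        have h1 : (s i).card ≤ (4 * n + 1) ^ d := by
          rw [card_boxFinset]
          exact Nat.pow_le_pow_left (by omega) d
        exact_mod_cast h1.trans ht.le
    _ = _ := by rw [Finset.sum_const, nsmul_eq_mul, Finset.card_range]; ring

theorem eventually_pow_lt_two_pow (d : ℕ) :
    ∀ᶠ t : ℕ in Filter.atTop, (4 * (t * t ^ 2) + 1) ^ d < 2 ^ t := by
  have h := tendsto_pow_const_div_const_pow_of_one_lt (3 * d + 1) (r := (2 : ℝ)) (by norm_num)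
  have h5 := (h.eventually (gt_mem_nhds (show (0 : ℝ) < 1 by norm_num)))
  filter_upwards [h5, Filter.eventually_ge_atTop (5 ^ d), Filter.eventually_ge_atTop 1]
    with t ht ht5 ht1
  rw [div_lt_one (by positivity)] at ht
  have ht' : t ^ (3 * d + 1) < 2 ^ t := by exact_mod_cast ht
  refine lt_of_le_of_lt ?_ ht'
  have h1 : 1 ≤ t ^ 3 := Nat.one_le_pow _ _ ht1
  calc (4 * (t * t ^ 2) + 1) ^ d ≤ (5 * t ^ 3) ^ d := Nat.pow_le_pow_left (by ring_nf; omega) d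
    _ = 5 ^ d * t ^ (3 * d) := by rw [mul_pow, ← pow_mul]
    _ ≤ t * t ^ (3 * d) := Nat.mul_le_mul_right _ ht5
    _ = t ^ (3 * d + 1) := by ring

/-- With shells of `t ^ 2` spheres, as soon as `a ^ t < 1 / 4` the expression is at most `t * (1 /
2) ^ t`. -/
theorem tendsto_failure_bound {a : ℝ} (h0 : 0 ≤ a) (h1 : a < 1) :
    Filter.Tendsto (fun t : ℕ => (t : ℝ) * 2 ^ t * a ^ (t ^ 2)) Filter.atTop (nhds 0) := by
  have hlim : Filter.Tendsto (fun t : ℕ => (t : ℝ) * (1 / 2 : ℝ) ^ t) Filter.atTop (nhds 0) :=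
    tendsto_self_mul_const_pow_of_lt_one (by norm_num) (by norm_num)
  have h4 := (tendsto_pow_atTop_nhds_zero_of_lt_one h0 h1).eventually
    (gt_mem_nhds (show (0 : ℝ) < 1 / 4 by norm_num))
  refine squeeze_zero' (Filter.Eventually.of_forall fun t => by positivity) ?_ hlim
  filter_upwards [h4] with t ht
  have e : (t : ℝ) * 2 ^ t * a ^ (t ^ 2) = t * (2 * a ^ t) ^ t := by
    rw [mul_pow, ← pow_mul, sq, mul_assoc]
  rw [e]
  exact mul_le_mul_of_nonneg_left (pow_le_pow_left₀ (by positivity) (by linarith) t) (by positivity)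

/-- Local uniqueness holds with probability close to one, uniformly in `X` and in the location. -/
theorem exists_scale_locallyConnected (hd : 2 ≤ d) {ε : unitInterval} (hε : 0 < ε) {δ : ℝ}
    (hδ : 0 < δ) (m : ℕ) :
    ∃ n : ℕ, m ≤ n ∧ 1 ≤ n ∧ ∀ X : Set (Sym2 (Fin d → ℤ)), X ⊆ latticeEdges d →
      EverywherePercolating X → ∀ z : Fin d → ℤ,
      (setBernoulli (latticeEdges d) ε).real {ω | ¬ LocallyConnected (X ∪ ω) z n} ≤ δ := by
  have h0 : (0 : ℝ) ≤ 1 - ε := by linarith [ε.2.2]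
  have h1 : (1 - ε : ℝ) < 1 := by
    have : (0 : ℝ) < ε := hε
    linarith
  obtain ⟨t, h2, h3, h4, h5⟩ := ((eventually_pow_lt_two_pow d).and
    (((tendsto_failure_bound h0 h1).eventually (gt_mem_nhds hδ)).and
    ((Filter.eventually_ge_atTop m).and (Filter.eventually_ge_atTop 1)))).exists
  have ht : t ≤ t * t ^ 2 := Nat.le_mul_of_pos_right _ (by positivity)
  refine ⟨t * t ^ 2, h4.trans ht, h5.trans ht, fun X hX hperc z => ?_⟩
  exact (setBernoulli_real_not_locallyConnected_le hd hX hperc ε z rfl h2).trans h3.le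

end LocalUniqueness

/-! ### The renormalized configuration dominates Bernoulli percolation. -/

section Renormalization

variable {d : ℕ} {X Y Y' : Set (Sym2 (Fin d → ℤ))}

theorem mem_renormalize_iff {n : ℕ} {x y : Fin d → ℤ} :
    s(x, y) ∈ renormalize n Y ↔ (lattice d).Adj x y ∧
      ConnectedInside Y (box ((n : ℤ) • (x + y)) (2 * n)) ((2 * n : ℤ) • x) ((2 * n : ℤ) • y) := by
  constructor
  · rintro ⟨x', y', hadj, he, hc⟩
    rw [Sym2.eq_iff] at he
    rcases he with ⟨rfl, rfl⟩ | ⟨rfl, rfl⟩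
    · exact ⟨hadj, hc⟩
    · exact ⟨hadj.symm, by rw [add_comm]; exact hc.symm⟩
  · rintro ⟨hadj, hc⟩
    exact ⟨x, y, hadj, rfl, hc⟩

theorem renormalize_mono (n : ℕ) (h : Y ⊆ Y') : renormalize n Y ⊆ renormalize n Y' := by
  rintro e ⟨x, y, hadj, rfl, hc⟩
  exact ⟨x, y, hadj, rfl, hc.mono (fun _ _ _ _ h' => h h') le_rfl⟩

/-- The pairs of points of the box of radius `r` around `z`. -/
noncomputable def boxPairs (z : Fin d → ℤ) (r : ℕ) : Finset (Sym2 (Fin d → ℤ)) := by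
  classical exact (boxFinset z r ×ˢ boxFinset z r).image fun p => s(p.1, p.2)

theorem mem_boxPairs {z u v : Fin d → ℤ} {r : ℕ} :
    s(u, v) ∈ boxPairs z r ↔ u ∈ box z r ∧ v ∈ box z r := by
  simp only [boxPairs, Finset.mem_image, Finset.mem_product, mem_boxFinset, Prod.exists,
    Sym2.eq_iff]
  constructor
  · rintro ⟨a, b, ⟨ha, hb⟩, ⟨rfl, rfl⟩ | ⟨rfl, rfl⟩⟩
    · exact ⟨ha, hb⟩
    · exact ⟨hb, ha⟩
  · exact fun h => ⟨u, v, h, Or.inl ⟨rfl, rfl⟩⟩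

theorem card_boxPairs_le (z : Fin d → ℤ) (r : ℕ) :
    (boxPairs z r).card ≤ (2 * r + 1) ^ d * (2 * r + 1) ^ d := by
  rw [boxPairs]
  refine Finset.card_image_le.trans ?_
  rw [Finset.card_product, card_boxFinset]

/-- In the pair `ω`, the first component is the set of added edges and the second is the thinning.
Both matter only inside the box attached to the edge, which is the source of the finite range of
dependence. -/
theorem determinedBy_mem_renormalize (X : Set (Sym2 (Fin d → ℤ))) (n : ℕ) (x y : Fin d → ℤ) :
    DeterminedBy (boxPairs ((n : ℤ) • (x + y)) (2 * n) : Set (Sym2 (Fin d → ℤ)))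
      fun ω => s(x, y) ∈ renormalize n ((X ∪ ω.1) ∩ ω.2) := by
  intro ω
  simp only [mem_renormalize_iff, eq_iff_iff]
  refine and_congr_right fun _ => ⟨fun h => h.mono ?_ le_rfl, fun h => h.mono ?_ le_rfl⟩
  · intro u v hu hv h
    have := Finset.mem_coe.2 (mem_boxPairs.2 ⟨hu, hv⟩)
    exact ⟨h.1.imp id fun h' => ⟨h', this⟩, h.2, this⟩
  · intro u v _ _ h
    exact ⟨h.1.imp id And.left, h.2.1⟩

theorem DeterminedBy.mono {ι β : Type*} {F G : Set ι} {f : Set ι × Set ι → β}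
    (hf : DeterminedBy F f) (h : F ⊆ G) : DeterminedBy G f := by
  intro ω
  rw [hf ω, hf (ω.1 ∩ G, ω.2 ∩ G)]
  simp only [Set.inter_assoc, Set.inter_eq_right.2 h]

theorem measurable_renormalize (X : Set (Sym2 (Fin d → ℤ))) (n : ℕ) :
    Measurable fun ω : Set (Sym2 (Fin d → ℤ)) × Set (Sym2 (Fin d → ℤ)) =>
      renormalize n ((X ∪ ω.1) ∩ ω.2) := by
  refine measurable_set_iff.2 fun e => ?_
  induction e with
  | h x y => exact (determinedBy_mem_renormalize X n x y).measurable

/-- Boxes attached to two edges only meet when the edges are close. -/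
theorem mem_boxPairs_of_meet {n : ℕ} (hn : 1 ≤ n) {x y x' y' v : Fin d → ℤ}
    (h : (lattice d).Adj x y) (h' : (lattice d).Adj x' y')
    (hv : v ∈ box ((n : ℤ) • (x + y)) (2 * n)) (hv' : v ∈ box ((n : ℤ) • (x' + y')) (2 * n)) :
    s(x', y') ∈ boxPairs x 3 := by
  have key : ∀ i, |x' i - x i| ≤ 3 ∧ |y' i - x i| ≤ 3 := by
    intro i
    have h1 := hv i
    have h2 := hv' i
    have h3 := abs_sub_le_one_of_adj h i
    have h4 := abs_sub_le_one_of_adj h' i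
    simp only [Pi.smul_apply, Pi.add_apply, smul_eq_mul, abs_le] at h1 h2 h3 h4 ⊢
    push_cast at h1 h2
    have hn' : (1 : ℤ) ≤ n := by exact_mod_cast hn
    -- Both centres are within `2n` of `v`, so `n` times this difference is at most `4n`. Since
    -- endpoints of an edge differ by at most one, `2 * |x' i - x i| ≤ 6`, whence the radius `3`.
    have h5 : (x i + y i) - (x' i + y' i) ≤ 4 := by
      by_contra hc
      nlinarith
    have h6 : (x' i + y' i) - (x i + y i) ≤ 4 := by
      by_contra hc
      nlinarith
    omega
  exact mem_boxPairs.2 ⟨fun i => (key i).1, fun i => (key i).2⟩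

theorem indepFun_renormalize (X : Set (Sym2 (Fin d → ℤ))) {n : ℕ} (hn : 1 ≤ n)
    (ε q : unitInterval) {x y : Fin d → ℤ} (h : (lattice d).Adj x y)
    (M : Finset (Sym2 (Fin d → ℤ))) (hM : ∀ e ∈ M, e ∈ latticeEdges d)
    (hdisj : Disjoint M (boxPairs x 3)) :
    IndepFun (fun ω => s(x, y) ∈ renormalize n ((X ∪ ω.1) ∩ ω.2))
      (fun ω (e : M) => (e : Sym2 (Fin d → ℤ)) ∈ renormalize n ((X ∪ ω.1) ∩ ω.2))
      ((setBernoulli (latticeEdges d) ε).prod (setBernoulli (latticeEdges d) q)) := by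
  classical
  have hF : ∀ e : Sym2 (Fin d → ℤ), ∃ F : Finset (Sym2 (Fin d → ℤ)),
      (e ∈ M → Disjoint (boxPairs ((n : ℤ) • (x + y)) (2 * n)) F) ∧
      DeterminedBy (F : Set _) fun ω => e ∈ renormalize n ((X ∪ ω.1) ∩ ω.2) := by
    intro e
    induction e with
    | h x' y' =>
      refine ⟨_, fun he => ?_, determinedBy_mem_renormalize X n x' y'⟩
      rw [Finset.disjoint_left]
      intro f hf hf'
      induction f with
      | h u v =>
        exact Finset.disjoint_left.1 hdisj he (mem_boxPairs_of_meet hn h (hM _ he)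
          (mem_boxPairs.1 hf).1 (mem_boxPairs.1 hf').1)
  choose F hF1 hF2 using hF
  refine DeterminedBy.indepFun (F := boxPairs ((n : ℤ) • (x + y)) (2 * n)) (G := M.biUnion F)
    _ _ ε q ?_ (determinedBy_mem_renormalize X n x y) ?_
  · rw [Finset.disjoint_biUnion_right]
    exact fun e he => hF1 e he
  · intro ω
    funext e
    refine ((hF2 e).mono ?_) ω
    exact_mod_cast Finset.subset_biUnion_of_mem F e.2

theorem mem_renormalize_of_locallyConnected {n : ℕ} {x y : Fin d → ℤ} (h : (lattice d).Adj x y)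
    {ω ζ : Set (Sym2 (Fin d → ℤ))}
    (hloc : LocallyConnected (X ∪ ω) ((n : ℤ) • (x + y)) n)
    (hζ : ∀ e ∈ boxPairs ((n : ℤ) • (x + y)) (2 * n), e ∈ X ∪ ω → e ∈ ζ) :
    s(x, y) ∈ renormalize n ((X ∪ ω) ∩ ζ) := by
  rw [mem_renormalize_iff]
  refine ⟨h, (hloc _ ?_ _ ?_).mono
    (fun u v hu hv huv => ⟨huv, hζ _ (mem_boxPairs.2 ⟨hu, hv⟩) huv⟩) le_rfl⟩
  -- The difference `2nx - n(x + y) = n(x - y)` has sup norm at most `n`, and likewise for `y`.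
  all_goals
    intro i
    have h3 := abs_sub_le_one_of_adj h i
    simp only [Pi.smul_apply, Pi.add_apply, smul_eq_mul, abs_le] at h3 ⊢
    have hn' : (0 : ℤ) ≤ n := by positivity
    constructor <;> nlinarith

/-- Up to a null event, a closed renormalized edge forces either a failure of local uniqueness or
the deletion, by the thinning, of some lattice edge of the box. -/
theorem real_notMem_renormalize_le (hX : X ⊆ latticeEdges d) (ε q : unitInterval) {n : ℕ} {δ : ℝ}
    (hloc : ∀ z : Fin d → ℤ,
      (setBernoulli (latticeEdges d) ε).real {ω | ¬ LocallyConnected (X ∪ ω) z n} ≤ δ)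
    {x y : Fin d → ℤ} (h : (lattice d).Adj x y) :
    ((setBernoulli (latticeEdges d) ε).prod (setBernoulli (latticeEdges d) q)).real
      {ω | s(x, y) ∉ renormalize n ((X ∪ ω.1) ∩ ω.2)} ≤
      δ + ((4 * n + 1) ^ d * (4 * n + 1) ^ d : ℕ) * (1 - q : ℝ) := by
  classical
  set P := setBernoulli (latticeEdges d) ε
  set Q := setBernoulli (latticeEdges d) q
  set z := (n : ℤ) • (x + y) with hz
  set F := (boxPairs z (2 * n)).filter (· ∈ latticeEdges d) with hFdef
  set A : Set (Set (Sym2 (Fin d → ℤ))) := {ω | ¬ LocallyConnected (X ∪ ω) z n}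
  set B : Set (Set (Sym2 (Fin d → ℤ))) := {ω | ¬ ω ⊆ latticeEdges d}
  have hB : P.real B = 0 := by
    rw [measureReal_def, show P B = 0 from setBernoulli_ae_subset]; rfl
  have hF : ∀ e ∈ F, Q.real {ζ | e ∉ ζ} = 1 - q := fun e he =>
    setBernoulli_real_notMem q (Finset.mem_filter.1 he).2
  have hsub : {ω : Set (Sym2 (Fin d → ℤ)) × Set (Sym2 (Fin d → ℤ)) |
      s(x, y) ∉ renormalize n ((X ∪ ω.1) ∩ ω.2)} ⊆
      ((A ∪ B) ×ˢ Set.univ) ∪ (Set.univ ×ˢ ⋃ e ∈ F, {ζ | e ∉ ζ}) := by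
    rintro ⟨ω, ζ⟩ hω
    by_contra hno
    simp only [Set.mem_union, Set.mem_prod, Set.mem_univ, and_true, true_and, Set.mem_iUnion,
      not_or, not_exists, A, B, Set.mem_ofPred_eq, not_not] at hno
    obtain ⟨⟨h1, h2⟩, h3⟩ := hno
    refine hω (mem_renormalize_of_locallyConnected h h1 fun e he heX => ?_)
    refine h3 e (Finset.mem_filter.2 ⟨he, ?_⟩)
    exact heX.elim (fun h => hX h) fun h => h2 h
  calc _ ≤ (P.prod Q).real (((A ∪ B) ×ˢ Set.univ) ∪ (Set.univ ×ˢ ⋃ e ∈ F, {ζ | e ∉ ζ})) :=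
        measureReal_mono hsub (measure_ne_top _ _)
    _ ≤ (P.prod Q).real ((A ∪ B) ×ˢ Set.univ) +
          (P.prod Q).real (Set.univ ×ˢ ⋃ e ∈ F, {ζ | e ∉ ζ}) := measureReal_union_le _ _
    _ = P.real (A ∪ B) + Q.real (⋃ e ∈ F, {ζ | e ∉ ζ}) := by
        rw [measureReal_prod_prod, measureReal_prod_prod]; simp
    _ ≤ (P.real A + P.real B) + ∑ e ∈ F, Q.real {ζ | e ∉ ζ} :=
        add_le_add (measureReal_union_le _ _) (measureReal_biUnion_finset_le _ _)
    _ ≤ δ + ((4 * n + 1) ^ d * (4 * n + 1) ^ d : ℕ) * (1 - q : ℝ) := by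
        rw [hB, add_zero, Finset.sum_congr rfl hF, Finset.sum_const, nsmul_eq_mul]
        refine add_le_add (hloc z) (mul_le_mul_of_nonneg_right ?_ (by linarith [q.2.2]))
        have h1 := (Finset.card_filter_le (boxPairs z (2 * n)) (· ∈ latticeEdges d)).trans
          (card_boxPairs_le z (2 * n))
        rw [show 2 * (2 * n) + 1 = 4 * n + 1 by ring] at h1
        exact_mod_cast h1

/-- At a large scale, the renormalization of a slightly thinned version of `X ∪ ω` dominates
Bernoulli percolation, uniformly in `X`. -/
theorem exists_scale_stochasticallyDominates (hd : 2 ≤ d) {ε : unitInterval} (hε : 0 < ε)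
    {p : unitInterval} (hp : p < 1) :
    ∃ n : ℕ, 1 ≤ n ∧ ∃ q : unitInterval, q < 1 ∧ ∀ X : Set (Sym2 (Fin d → ℤ)),
      X ⊆ latticeEdges d → EverywherePercolating X →
      StochasticallyDominates
        ((setBernoulli (latticeEdges d) ε).prod (setBernoulli (latticeEdges d) q))
        (fun ω => renormalize n ((X ∪ ω.1) ∩ ω.2)) (setBernoulli (latticeEdges d) p) := by
  have hp1 : (p : ℝ) < 1 := hp
  have hp0 : (0 : ℝ) ≤ p := p.2.1
  -- This choice gives `r < 1` and `r ^ 2 - p = (1 - p) ^ 2 / 4 ≥ 0`.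
  set r : ℝ := (1 + p) / 2 with hr
  have hr0 : 0 < r := by rw [hr]; linarith
  have hr1 : r < 1 := by rw [hr]; linarith
  -- A bound for the number of pairs in a box of radius `3`, outside of which edges are independent
  -- of the given one.
  set Δ : ℕ := 7 ^ d * 7 ^ d with hΔ
  set δ : ℝ := (1 - r) * (r * (1 - r)) ^ Δ with hδ
  have hδ0 : 0 < δ := mul_pos (by linarith) (pow_pos (mul_pos hr0 (by linarith)) _)
  obtain ⟨n, -, hn, hloc⟩ := exists_scale_locallyConnected hd hε (half_pos hδ0) 0
  set k : ℕ := (4 * n + 1) ^ d * (4 * n + 1) ^ d with hk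
  have hk0 : (0 : ℝ) < k := by rw [hk]; positivity
  -- The deletion probability of the thinning: over at most `k` edges of a box it costs at most `δ /
  -- 2`, the other half being spent on local uniqueness.
  set a : ℝ := min 1 (δ / (2 * k)) with ha
  have ha0 : 0 < a := lt_min one_pos (by positivity)
  have ha1 : a ≤ 1 := min_le_left _ _
  refine ⟨n, hn, ⟨1 - a, by linarith, by linarith⟩, ?_, fun X hX hperc => ?_⟩
  · exact Subtype.coe_lt_coe.1 (show (1 - a : ℝ) < 1 by linarith)
  refine stochasticallyDominates_of_dependence (measurable_renormalize X n) p hr0.le hr1.le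
    (by rw [hr]; nlinarith [sq_nonneg ((p : ℝ) - 1)]) Δ ?_ ?_
  · intro e he
    induction e with
    | h x y =>
      refine (real_notMem_renormalize_le hX ε _ (hloc X hX hperc) he).trans ?_
      rw [← hδ, ← hk]
      have : (k : ℝ) * a ≤ δ / 2 := by
        calc (k : ℝ) * a ≤ k * (δ / (2 * k)) := mul_le_mul_of_nonneg_left (min_le_right _ _) hk0.le
          _ = δ / 2 := by field_simp
      simp only [sub_sub_cancel]
      linarith
  · intro e he
    induction e with
    | h x y =>
      exact ⟨boxPairs x 3, card_boxPairs_le x 3, fun M hM hdisj =>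
        indepFun_renormalize X hn ε _ he M hM hdisj⟩

end Renormalization

/-! ### Planar duality and Peierls' argument in the quarter plane. -/

section QuarterPlane

/-- Edges of the quarter plane `ℕ²`: `(false, i, j)` joins `(i, j)` to `(i + 1, j)` and
`(true, i, j)` joins `(i, j)` to `(i, j + 1)`. -/
abbrev QuarterEdge : Type := Bool × ℕ × ℕ

/-- The first endpoint of an edge of the quarter plane. -/
def QuarterEdge.src (e : QuarterEdge) : ℕ × ℕ := e.2

/-- The second endpoint of an edge of the quarter plane. -/
def QuarterEdge.tgt (e : QuarterEdge) : ℕ × ℕ :=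
  if e.1 then (e.2.1, e.2.2 + 1) else (e.2.1 + 1, e.2.2)

/-- The edges of the unit square with lower left corner `(i, j)`. -/
def squareEdges (i j : ℕ) : Finset QuarterEdge :=
  {(false, i, j), (false, i, j + 1), (true, i, j), (true, i + 1, j)}

/-- The edges sharing a unit square with `e`. -/
def squareNeighbors (e : QuarterEdge) : Finset QuarterEdge :=
  squareEdges e.2.1 e.2.2 ∪
    if e.1 then squareEdges (e.2.1 - 1) e.2.2 else squareEdges e.2.1 (e.2.2 - 1)

theorem card_squareNeighbors_le (e : QuarterEdge) : (squareNeighbors e).card ≤ 8 := by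
  have h : ∀ i j, (squareEdges i j).card ≤ 4 := fun i j => Finset.card_le_four
  unfold squareNeighbors
  refine (Finset.card_union_le _ _).trans ?_
  split_ifs
  · exact add_le_add (h _ _) (h _ _)
  · exact add_le_add (h _ _) (h _ _)

theorem mem_squareNeighbors {e f : QuarterEdge} {i j : ℕ} (he : e ∈ squareEdges i j)
    (hf : f ∈ squareEdges i j) : f ∈ squareNeighbors e := by
  unfold squareNeighbors
  simp only [squareEdges, Finset.mem_insert, Finset.mem_singleton] at he
  rw [Finset.mem_union]
  rcases he with rfl | rfl | rfl | rfl
  · left; exact hf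
  · right; simpa using hf
  · left; exact hf
  · right; simpa using hf

theorem fst_le_of_mem_squareEdges {e f : QuarterEdge} {i j : ℕ} (he : e ∈ squareEdges i j)
    (hf : f ∈ squareEdges i j) : e.2.1 ≤ f.2.1 + 1 := by
  simp only [squareEdges, Finset.mem_insert, Finset.mem_singleton] at he hf
  rcases he with rfl | rfl | rfl | rfl <;> rcases hf with rfl | rfl | rfl | rfl <;>
    (dsimp only; omega)

/-- Discrete Stokes formula for a `ZMod 2`-valued function on edges which is closed on unit
squares. -/
theorem sum_boundary_eq {a : QuarterEdge → ZMod 2}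
    (ha : ∀ i j, a (false, i, j) + a (false, i, j + 1) + a (true, i, j) + a (true, i + 1, j) = 0)
    (N M : ℕ) :
    ∑ k ∈ Finset.range N, a (false, k, 0) + ∑ l ∈ Finset.range M, a (true, N, l) =
      ∑ l ∈ Finset.range M, a (true, 0, l) + ∑ k ∈ Finset.range N, a (false, k, M) := by
  have two : ∀ t : ZMod 2, t + t = 0 := CharTwo.add_self_eq_zero
  have row : ∀ M, ∑ k ∈ Finset.range N, a (false, k, M) + a (true, N, M) =
      a (true, 0, M) + ∑ k ∈ Finset.range N, a (false, k, M + 1) := by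
    intro M
    induction N with
    | zero => simp
    | succ N ih =>
      rw [Finset.sum_range_succ, Finset.sum_range_succ]
      linear_combination ih + ha N M - two (a (true, N, M)) - two (a (false, N, M + 1))
  induction M with
  | zero => simp
  | succ M ih =>
    rw [Finset.sum_range_succ, Finset.sum_range_succ]
    linear_combination ih + row M

/-- The edges with exactly one endpoint in `A`. -/
def edgeBoundary (A : Set (ℕ × ℕ)) : Set QuarterEdge :=
  {e | ¬ (e.src ∈ A ↔ e.tgt ∈ A)}

/-- Two edges of `S` are adjacent when they lie on a common unit square. -/
def squareGraph (S : Set QuarterEdge) : SimpleGraph QuarterEdge where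
  Adj e f := e ≠ f ∧ e ∈ S ∧ f ∈ S ∧ ∃ i j, e ∈ squareEdges i j ∧ f ∈ squareEdges i j
  symm := ⟨fun _ _ ⟨h1, h2, h3, i, j, h4, h5⟩ => ⟨h1.symm, h3, h2, i, j, h5, h4⟩⟩
  loopless := ⟨fun _ h => h.1 rfl⟩

/-- The boundary of a finite set containing the origin contains a dual path from the horizontal
axis to the vertical axis. -/
theorem exists_reachable_edgeBoundary {A : Set (ℕ × ℕ)} (hA : A.Finite) (h0 : (0, 0) ∈ A) :
    ∃ j l, (false, j, 0) ∈ edgeBoundary A ∧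
      (squareGraph (edgeBoundary A)).Reachable (false, j, 0) (true, 0, l) := by
  classical
  by_contra! hno
  -- the part of the boundary which is not connected to the vertical axis
  let S : Set QuarterEdge := {e | e ∈ edgeBoundary A ∧
    ∀ l, (true, 0, l) ∈ edgeBoundary A → ¬ (squareGraph (edgeBoundary A)).Reachable e (true, 0, l)}
  have hclosed : ∀ i j e f, e ∈ squareEdges i j → f ∈ squareEdges i j → e ∈ S →
      f ∈ edgeBoundary A → f ∈ S := by
    intro i j e f he hf heS hfA
    refine ⟨hfA, fun l hl hr => heS.2 l hl ?_⟩
    by_cases hef : e = f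
    · exact hef ▸ hr
    · exact (SimpleGraph.Adj.reachable (G := squareGraph (edgeBoundary A))
        ⟨hef, heS.1, hfA, i, j, he, hf⟩).trans hr
  let χ : ℕ × ℕ → ZMod 2 := fun v => if v ∈ A then 1 else 0
  have hχ : ∀ e : QuarterEdge, (if e ∈ edgeBoundary A then (1 : ZMod 2) else 0) =
      χ e.src + χ e.tgt := by
    intro e
    by_cases h1 : e.src ∈ A <;> by_cases h2 : e.tgt ∈ A <;> simp [edgeBoundary, χ, h1, h2]
    exact (CharTwo.add_self_eq_zero (1 : ZMod 2)).symm
  have two : ∀ t : ZMod 2, t + t = 0 := CharTwo.add_self_eq_zero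
  let a : QuarterEdge → ZMod 2 := fun e => if e ∈ S then 1 else 0
  -- A unit square meets the boundary of `A` in an even number of edges, and `S` contains either all
  -- or none of them.
  have ha : ∀ i j, a (false, i, j) + a (false, i, j + 1) + a (true, i, j) + a (true, i + 1, j) =
      0 := by
    intro i j
    by_cases hex : ∃ e ∈ squareEdges i j, e ∈ S
    · obtain ⟨e, he, heS⟩ := hex
      have hsame : ∀ f ∈ squareEdges i j, a f = χ f.src + χ f.tgt := by
        intro f hf
        rw [← hχ f]
        have : f ∈ S ↔ f ∈ edgeBoundary A := ⟨fun h => h.1, hclosed i j e f he hf heS⟩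
        simp only [a, this]
      rw [hsame _ (by simp [squareEdges]), hsame _ (by simp [squareEdges]),
        hsame _ (by simp [squareEdges]), hsame _ (by simp [squareEdges])]
      simp only [QuarterEdge.src, QuarterEdge.tgt, if_true, Bool.false_eq_true, if_false]
      linear_combination two (χ (i, j)) + two (χ (i + 1, j)) + two (χ (i, j + 1)) +
        two (χ (i + 1, j + 1))
    · push Not at hex
      have : ∀ f ∈ squareEdges i j, a f = 0 := fun f hf => if_neg (hex f hf)
      rw [this _ (by simp [squareEdges]), this _ (by simp [squareEdges]),
        this _ (by simp [squareEdges]), this _ (by simp [squareEdges])]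
      simp
  obtain ⟨N, hN⟩ : ∃ N : ℕ, ∀ v ∈ A, v.1 < N ∧ v.2 < N := by
    obtain ⟨B, hB⟩ := (hA.image fun v => max v.1 v.2).bddAbove
    refine ⟨B + 1, fun v hv => ?_⟩
    have := hB (Set.mem_image_of_mem (fun v : ℕ × ℕ => max v.1 v.2) hv)
    simp only [max_le_iff] at this
    omega
  have hfar : ∀ e : QuarterEdge, e.src ∉ A → e.tgt ∉ A → a e = 0 := by
    intro e h1 h2
    refine if_neg fun h => h.1 ?_
    simp [h1, h2]
  -- On a large square the right and top sides avoid `A`, and the left side has no edge of `S`. The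
  -- bottom side goes from inside `A` to outside, so it crosses the boundary an odd number of times,
  -- each crossing being in `S` by `hno`. The formula then reads `1 = 0`.
  have hstokes := sum_boundary_eq ha N N
  have hv0 : ∑ l ∈ Finset.range N, a (true, N, l) = 0 :=
    Finset.sum_eq_zero fun l _ => hfar _ (fun h => by have := (hN _ h).1; simp [QuarterEdge.src] at this)
      (fun h => by have := (hN _ h).1; simp [QuarterEdge.tgt] at this)
  have hh0 : ∑ k ∈ Finset.range N, a (false, k, N) = 0 :=
    Finset.sum_eq_zero fun k _ => hfar _ (fun h => by have := (hN _ h).2; simp [QuarterEdge.src] at this)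
      (fun h => by have := (hN _ h).2; simp [QuarterEdge.tgt] at this)
  have hvert : ∑ l ∈ Finset.range N, a (true, 0, l) = 0 :=
    Finset.sum_eq_zero fun l _ => if_neg fun h => h.2 l h.1 (SimpleGraph.Reachable.refl _)
  have hhor : ∑ k ∈ Finset.range N, a (false, k, 0) = 1 := by
    have e1 : ∀ k ∈ Finset.range N, a (false, k, 0) = χ (k + 1, 0) - χ (k, 0) := by
      intro k _
      have h1 := hχ (false, k, 0)
      simp only [QuarterEdge.src, QuarterEdge.tgt, Bool.false_eq_true, if_false] at h1
      have : (false, k, 0) ∈ S ↔ (false, k, 0) ∈ edgeBoundary A :=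
        ⟨fun h => h.1, fun h => ⟨h, fun l _ => hno k l h⟩⟩
      simp only [a, this, h1]
      linear_combination two (χ (k, 0))
    rw [Finset.sum_congr rfl e1, Finset.sum_range_sub (fun k => χ (k, 0))]
    have hNA : (N, 0) ∉ A := fun h => by have := (hN _ h).1; simp at this
    simp only [χ, h0, hNA, if_true, if_false]
    decide
  rw [hv0, hh0, hvert, hhor] at hstokes
  revert hstokes
  decide

/-- The sequences of `n + 1` edges starting from `e` in which consecutive edges share a square. -/
def dualPaths : ℕ → QuarterEdge → Finset (List QuarterEdge)
  | 0, e => {[e]}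
  | n + 1, e => (squareNeighbors e).biUnion fun f => (dualPaths n f).image (e :: ·)

theorem card_dualPaths_le (n : ℕ) (e : QuarterEdge) : (dualPaths n e).card ≤ 8 ^ n := by
  induction n generalizing e with
  | zero => simp [dualPaths]
  | succ n ih =>
    calc (dualPaths (n + 1) e).card
        ≤ (squareNeighbors e).card * 8 ^ n :=
          Finset.card_biUnion_le_card_mul _ _ _ fun f _ => Finset.card_image_le.trans (ih f)
      _ ≤ 8 * 8 ^ n := Nat.mul_le_mul_right _ (card_squareNeighbors_le e)
      _ = 8 ^ (n + 1) := by ring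

theorem length_of_mem_dualPaths {n : ℕ} {e : QuarterEdge} {L : List QuarterEdge}
    (hL : L ∈ dualPaths n e) : L.length = n + 1 := by
  induction n generalizing e L with
  | zero => simp [dualPaths] at hL; simp [hL]
  | succ n ih =>
    simp only [dualPaths, Finset.mem_biUnion, Finset.mem_image] at hL
    obtain ⟨f, _, L', hL', rfl⟩ := hL
    simp [ih hL']

/-- Truncation to a prescribed length allows a finite union bound, and self-avoidance keeps the
edges distinct, hence independent. -/
theorem exists_dualPath_of_walk {S : Set QuarterEdge} {e f : QuarterEdge}
    (w : (squareGraph S).Walk e f) (hw : w.IsPath) {n : ℕ} (hn : n ≤ w.length) :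
    ∃ L ∈ dualPaths n e, L.Nodup ∧ ∀ g ∈ L, g ∈ w.support := by
  induction w generalizing n with
  | nil =>
    simp only [SimpleGraph.Walk.length_nil, Nat.le_zero] at hn
    subst hn
    exact ⟨_, Finset.mem_singleton_self _, by simp, by simp⟩
  | @cons u v w' h p ih =>
    rcases n with _ | n
    · exact ⟨_, Finset.mem_singleton_self _, by simp, by simp⟩
    · rw [SimpleGraph.Walk.cons_isPath_iff] at hw
      obtain ⟨L, hL, hnd, hsub⟩ := ih hw.1 (n := n) (by simpa using hn)
      obtain ⟨_, _, _, i, j, h4, h5⟩ := id h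
      refine ⟨u :: L, ?_, ?_, ?_⟩
      · simp only [dualPaths, Finset.mem_biUnion, Finset.mem_image]
        exact ⟨v, mem_squareNeighbors h4 h5, L, hL, rfl⟩
      · exact List.nodup_cons.2 ⟨fun hu => hw.2 (hsub u hu), hnd⟩
      · intro g hg
        rcases List.mem_cons.1 hg with rfl | hg
        · simp
        · simp [hsub g hg]

/-- The abscissa drops by at most one per dual step, so a dual path from the `j`-th edge of the
horizontal axis to the vertical axis has at least `j` steps. -/
theorem fst_le_length {S : Set QuarterEdge} {e f : QuarterEdge} (w : (squareGraph S).Walk e f) :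
    e.2.1 ≤ f.2.1 + w.length := by
  induction w with
  | nil => simp
  | cons h p ih =>
    obtain ⟨_, _, _, i, j, h4, h5⟩ := id h
    have := fst_le_of_mem_squareEdges h4 h5
    simp only [SimpleGraph.Walk.length_cons]
    omega

theorem mem_of_mem_support {S : Set QuarterEdge} {e f : QuarterEdge} (w : (squareGraph S).Walk e f)
    (he : e ∈ S) : ∀ g ∈ w.support, g ∈ S := by
  induction w with
  | nil => simpa using he
  | cons h p ih =>
    intro g hg
    rcases List.mem_cons.1 (by simpa using hg) with rfl | hg
    · exact he
    · exact ih h.2.2.1 g hg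

/-- There is a self-avoiding closed dual path of `j + 1` edges from the `j`-th horizontal edge of
the axis. -/
def Blocked (O : Set QuarterEdge) (j : ℕ) : Prop :=
  ∃ L ∈ dualPaths j (false, j, 0), L.Nodup ∧ ∀ g ∈ L, g ∉ O

/-- One step along an open edge. -/
def OpenStep (O : Set QuarterEdge) (u v : ℕ × ℕ) : Prop :=
  ∃ e ∈ O, (e.src = u ∧ e.tgt = v) ∨ (e.src = v ∧ e.tgt = u)

/-- **Peierls' argument.** Without closed dual paths started far away there is an infinite
cluster. -/
theorem exists_infinite_cluster {O : Set QuarterEdge} {m : ℕ} (h : ∀ j ≥ m, ¬ Blocked O j) :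
    ∃ i, {v | Relation.ReflTransGen (OpenStep O) (i, 0) v}.Infinite := by
  by_contra! hfin
  -- Taking the clusters of all of `(0, 0), …, (m, 0)` ensures that a boundary edge on the
  -- horizontal axis has index at least `m`, where blocking is excluded.
  set A : Set (ℕ × ℕ) := ⋃ i ∈ Finset.range (m + 1),
    {v | Relation.ReflTransGen (OpenStep O) (i, 0) v} with hA
  have hAfin : A.Finite := Set.Finite.biUnion (Finset.finite_toSet _) fun i _ => hfin i
  have hmem : ∀ i ≤ m, (i, 0) ∈ A := fun i hi =>
    Set.mem_biUnion (by simp; omega) Relation.ReflTransGen.refl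
  have hstep : ∀ u v, u ∈ A → OpenStep O u v → v ∈ A := by
    intro u v hu huv
    simp only [hA, Set.mem_iUnion] at hu ⊢
    obtain ⟨i, hi, hu⟩ := hu
    exact ⟨i, hi, hu.tail huv⟩
  have hclosed : ∀ e ∈ edgeBoundary A, e ∉ O := fun e he heO =>
    he ⟨fun h => hstep _ _ h ⟨e, heO, Or.inl ⟨rfl, rfl⟩⟩,
      fun h => hstep _ _ h ⟨e, heO, Or.inr ⟨rfl, rfl⟩⟩⟩
  obtain ⟨j, l, hj, hr⟩ := exists_reachable_edgeBoundary hAfin (hmem 0 (Nat.zero_le m))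
  have hjm : m ≤ j := by
    by_contra hlt
    refine hj ⟨fun _ => ?_, fun _ => ?_⟩
    · exact hmem (j + 1) (by omega)
    · exact hmem j (by omega)
  obtain ⟨w, hw⟩ := hr.exists_isPath
  have hlen := fst_le_length w
  obtain ⟨L, hL, hnd, hsub⟩ := exists_dualPath_of_walk w hw (n := j) (by simpa using hlen)
  exact h j hjm ⟨L, hL, hnd, fun g hg => hclosed g (mem_of_mem_support w hj g (hsub g hg))⟩

end QuarterPlane

/-! ### Percolation in a thick quarter plane, connectedness and the critical parameter. -/

section Percolation

variable {d : ℕ} {X Y Y' : Set (Sym2 (Fin d → ℤ))} {S S' : Set (Fin d → ℤ)}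

theorem percolatesIn_iff : PercolatesIn Y S ↔ ∃ x, {y | ConnectedInside Y S x y}.Infinite := by
  constructor
  · rintro ⟨C, hC⟩
    induction C using SimpleGraph.ConnectedComponent.ind with
    | h x =>
      refine ⟨x, (hC.image Subtype.val_injective.injOn).mono ?_⟩
      rintro _ ⟨y, hy, rfl⟩
      exact ⟨x.2, y.2, (SimpleGraph.ConnectedComponent.exact hy).symm⟩
  · rintro ⟨x, hx⟩
    obtain ⟨y, hxS, _⟩ := hx.nonempty
    refine ⟨((graph Y).induce S).connectedComponentMk ⟨x, hxS⟩, fun hfin => hx ?_⟩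
    refine (hfin.image Subtype.val).subset ?_
    rintro y ⟨_, hy, hr⟩
    exact ⟨⟨y, hy⟩, SimpleGraph.ConnectedComponent.sound hr.symm, rfl⟩

theorem PercolatesIn.mono (hY : Y ⊆ Y') (hS : S ⊆ S') (h : PercolatesIn Y S) :
    PercolatesIn Y' S' := by
  rw [percolatesIn_iff] at h ⊢
  obtain ⟨x, hx⟩ := h
  exact ⟨x, hx.mono fun y hy => ConnectedInside.mono (fun _ _ _ _ h => hY h) hS hy⟩

theorem ConnectedInside.reachable {x y : Fin d → ℤ} (h : ConnectedInside Y S x y) :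
    (graph Y).Reachable x y := by
  obtain ⟨_, _, h⟩ := h
  exact h.map (SimpleGraph.Embedding.induce S).toHom

/-- The embedding of the quarter plane in `ℤ^d`, with all coordinates positive and the coordinates
from the third on equal to one. -/
def quarterVertex (d : ℕ) (v : ℕ × ℕ) : Fin d → ℤ :=
  fun k => if (k : ℕ) = 0 then v.1 + 1 else if (k : ℕ) = 1 then v.2 + 1 else 1

theorem quarterVertex_injective (hd : 2 ≤ d) : Function.Injective (quarterVertex d) := by
  intro u v huv
  have h0 := congrFun huv ⟨0, by omega⟩
  have h1 := congrFun huv ⟨1, by omega⟩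
  simp only [quarterVertex, if_true, one_ne_zero, if_false] at h0 h1
  ext <;> omega

/-- The lattice edge corresponding to an edge of the quarter plane. -/
def quarterEdge (d : ℕ) (e : QuarterEdge) : Sym2 (Fin d → ℤ) :=
  s(quarterVertex d e.src, quarterVertex d e.tgt)

theorem adj_quarterVertex (hd : 2 ≤ d) (e : QuarterEdge) :
    (lattice d).Adj (quarterVertex d e.src) (quarterVertex d e.tgt) := by
  obtain ⟨b, i, j⟩ := e
  cases b
  · have h := adj_update (quarterVertex d (i, j)) ⟨0, by omega⟩ (i + 1)
    convert h using 1 <;> funext k <;> by_cases hk : k = ⟨0, by omega⟩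
    · subst hk; simp [quarterVertex, QuarterEdge.src]
    · simp [hk, QuarterEdge.src]
    · subst hk; simp [quarterVertex, QuarterEdge.tgt]
    · have : (k : ℕ) ≠ 0 := fun h => hk (Fin.ext h)
      simp [hk, quarterVertex, QuarterEdge.tgt, this]
  · have h := adj_update (quarterVertex d (i, j)) ⟨1, by omega⟩ (j + 1)
    convert h using 1 <;> funext k <;> by_cases hk : k = ⟨1, by omega⟩
    · subst hk; simp [quarterVertex, QuarterEdge.src]
    · simp [hk, QuarterEdge.src]
    · subst hk; simp [quarterVertex, QuarterEdge.tgt]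
    · have : (k : ℕ) ≠ 1 := fun h => hk (Fin.ext h)
      simp [hk, quarterVertex, QuarterEdge.tgt, this]

theorem quarterEdge_injective (hd : 2 ≤ d) : Function.Injective (quarterEdge d) := by
  rintro ⟨b, i, j⟩ ⟨b', i', j'⟩ h
  have hinj := quarterVertex_injective hd
  rw [quarterEdge, quarterEdge, Sym2.eq_iff, hinj.eq_iff, hinj.eq_iff, hinj.eq_iff,
    hinj.eq_iff] at h
  cases b <;> cases b' <;> simp [QuarterEdge.src, QuarterEdge.tgt] at h ⊢ <;> omega

/-- The event that far away edges of the axis are not the start of long closed dual paths. -/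
def unblockedEvent (d : ℕ) : Set (Set (Sym2 (Fin d → ℤ))) :=
  {ω | ∀ᶠ j in Filter.atTop, ω ∉ {ω | Blocked (quarterEdge d ⁻¹' ω) j}}

theorem setOf_blocked_eq (d j : ℕ) :
    {ω : Set (Sym2 (Fin d → ℤ)) | Blocked (quarterEdge d ⁻¹' ω) j} =
      ⋃ L ∈ (dualPaths j (false, j, 0)).filter List.Nodup,
        {ω | ∀ e ∈ L.toFinset.image (quarterEdge d), e ∉ ω} := by
  ext ω
  simp only [Blocked, Set.mem_ofPred_eq, Set.mem_iUnion, Finset.mem_filter, Finset.forall_mem_image,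
    List.mem_toFinset, Set.mem_preimage, exists_prop, and_assoc]

theorem measurableSet_blocked (d j : ℕ) :
    MeasurableSet {ω : Set (Sym2 (Fin d → ℤ)) | Blocked (quarterEdge d ⁻¹' ω) j} := by
  rw [setOf_blocked_eq]
  refine Finset.measurableSet_biUnion _ fun L _ => ?_
  have : {ω : Set (Sym2 (Fin d → ℤ)) | ∀ e ∈ L.toFinset.image (quarterEdge d), e ∉ ω} =
      ⋂ e ∈ L.toFinset.image (quarterEdge d), {ω | e ∈ ω}ᶜ := by
    ext ω; simp
  rw [this]
  exact Finset.measurableSet_biInter _ fun e _ => (measurableSet_mem_coord e).compl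

/-- Stochastic domination is applied to this event rather than to percolation itself: it is a
countable combination of events depending on finitely many edges, and it is visibly increasing. -/
theorem measurableSet_unblockedEvent (d : ℕ) : MeasurableSet (unblockedEvent d) := by
  have : unblockedEvent d =
      ⋃ m, ⋂ j, ⋂ _ : m ≤ j, {ω | Blocked (quarterEdge d ⁻¹' ω) j}ᶜ := by
    ext ω; simp [unblockedEvent, Filter.eventually_atTop]
  rw [this]
  exact .iUnion fun m => .iInter fun j => .iInter fun _ => (measurableSet_blocked d j).compl

theorem isUpperSet_unblockedEvent (d : ℕ) : IsUpperSet (unblockedEvent d) := by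
  intro ω ω' hωω' hω
  refine Filter.Eventually.mono hω fun j hj hb => hj ?_
  obtain ⟨L, h1, h2, h3⟩ := hb
  exact ⟨L, h1, h2, fun g hg h => h3 g hg (hωω' h)⟩

/-- There are at most `8 ^ j` dual paths to consider, each made of `j + 1` distinct edges. -/
theorem setBernoulli_real_blocked_le (hd : 2 ≤ d) (p : unitInterval) (j : ℕ) :
    (setBernoulli (latticeEdges d) p).real {ω | Blocked (quarterEdge d ⁻¹' ω) j} ≤
      8 ^ j * (1 - p : ℝ) ^ (j + 1) := by
  have h0 : (0 : ℝ) ≤ 1 - p := by linarith [p.2.2]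
  rw [setOf_blocked_eq]
  refine (measureReal_biUnion_finset_le _ _).trans ?_
  calc _ ≤ ∑ L ∈ (dualPaths j (false, j, 0)).filter List.Nodup, (1 - p : ℝ) ^ (j + 1) := by
        refine Finset.sum_le_sum fun L hL => ?_
        rw [Finset.mem_filter] at hL
        rw [setBernoulli_real_disjoint, Finset.card_image_of_injective _ (quarterEdge_injective hd),
          List.toFinset_card_of_nodup hL.2, length_of_mem_dualPaths hL.1]
        intro e he
        obtain ⟨f, _, rfl⟩ := Finset.mem_image.1 he
        exact adj_quarterVertex hd f
    _ ≤ _ := by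
        rw [Finset.sum_const, nsmul_eq_mul]
        refine mul_le_mul_of_nonneg_right ?_ (by positivity)
        exact_mod_cast (Finset.card_filter_le _ _).trans (card_dualPaths_le _ _)

/-- Borel–Cantelli; the value `15 / 16` makes `8 * (1 - p) = 1 / 2`, so the blocking probabilities
are summable. -/
theorem setBernoulli_unblockedEvent (hd : 2 ≤ d) {p : unitInterval} (hp : (p : ℝ) = 15 / 16) :
    setBernoulli (latticeEdges d) p (unblockedEvent d) = 1 := by
  rw [prob_compl_eq_zero_iff (measurableSet_unblockedEvent d) |>.symm]
  refine ae_eventually_notMem (ne_top_of_le_ne_top (b := ∑' j : ℕ, ENNReal.ofReal ((1 / 2) ^ j)) ?_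
    (ENNReal.tsum_le_tsum fun j => ?_))
  · rw [← ENNReal.ofReal_tsum_of_nonneg (fun j => by positivity) summable_geometric_two]
    exact ENNReal.ofReal_ne_top
  · refine ENNReal.le_ofReal_iff_toReal_le (measure_ne_top _ _) (by positivity) |>.2 ?_
    refine (setBernoulli_real_blocked_le hd p j).trans ?_
    rw [hp, show (1 - 15 / 16 : ℝ) = 1 / 16 by norm_num, pow_succ, ← mul_assoc, ← mul_pow,
      show (8 * (1 / 16) : ℝ) = 1 / 2 by norm_num]
    refine mul_le_of_le_one_right (by positivity) (by norm_num)

/-- The points with nonnegative coordinates, those from the third on being at most `L`. -/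
def quarterSlab (d L : ℕ) : Set (Fin d → ℤ) :=
  {z | ∀ i : Fin d, 0 ≤ z i ∧ (2 ≤ (i : ℕ) → z i ≤ (L : ℤ))}

/-- Percolation of the renormalized configuration in the quarter plane implies percolation of the
original configuration in a thick quarter plane. -/
theorem percolatesIn_of_renormalize_mem (hd : 2 ≤ d) {n : ℕ} (hn : 1 ≤ n)
    (h : renormalize n Y ∈ unblockedEvent d) : PercolatesIn Y (quarterSlab d (4 * n)) := by
  obtain ⟨m, hm⟩ := Filter.eventually_atTop.1 h
  obtain ⟨i, hi⟩ := exists_infinite_cluster hm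
  let f : ℕ × ℕ → (Fin d → ℤ) := fun v => (2 * n : ℤ) • quarterVertex d v
  have hn0 : (0 : ℤ) < n := by exact_mod_cast hn
  have hf : Function.Injective f := by
    intro u v huv
    refine quarterVertex_injective hd (funext fun k => ?_)
    have := congrFun huv k
    simp only [f, Pi.smul_apply, smul_eq_mul] at this
    exact mul_left_cancel₀ (by positivity) this
  have hpos : ∀ v k, 1 ≤ quarterVertex d v k ∧ (2 ≤ (k : ℕ) → quarterVertex d v k = 1) := by
    intro v k
    simp only [quarterVertex]
    split_ifs <;> constructor <;> intros <;> omega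
  -- Since `quarterVertex` has coordinates at least one, the centre has coordinates at least `2n`
  -- and the box stays nonnegative. The coordinates from the third on are exactly `2n` at the
  -- centre, so they end at `4n`.
  have hbox : ∀ u v, box ((n : ℤ) • (quarterVertex d u + quarterVertex d v)) (2 * n) ⊆
      quarterSlab d (4 * n) := by
    intro u v z hz k
    have h1 := hz k
    simp only [Pi.smul_apply, Pi.add_apply, smul_eq_mul, abs_le] at h1
    push_cast at h1 ⊢
    obtain ⟨hu, hu'⟩ := hpos u k
    obtain ⟨hv, hv'⟩ := hpos v k
    refine ⟨by nlinarith, fun hk => ?_⟩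
    rw [hu' hk, hv' hk] at h1
    linarith
  have hstep : ∀ u v, OpenStep (quarterEdge d ⁻¹' renormalize n Y) u v →
      ConnectedInside Y (quarterSlab d (4 * n)) (f u) (f v) := by
    have key : ∀ e ∈ quarterEdge d ⁻¹' renormalize n Y,
        ConnectedInside Y (quarterSlab d (4 * n)) (f e.src) (f e.tgt) := fun e he =>
      (mem_renormalize_iff.1 he).2.mono (fun _ _ _ _ h => h) (hbox _ _)
    rintro u v ⟨e, he, ⟨rfl, rfl⟩ | ⟨rfl, rfl⟩⟩
    · exact key e he
    · exact (key e he).symm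
  rw [percolatesIn_iff]
  refine ⟨f (i, 0), (hi.image hf.injOn).mono ?_⟩
  rintro _ ⟨v, hv, rfl⟩
  induction hv with
  | refl =>
    refine .refl fun k => ?_
    obtain ⟨h1, h2⟩ := hpos (i, 0) k
    simp only [f, Pi.smul_apply, smul_eq_mul]
    refine ⟨by nlinarith, fun hk => ?_⟩
    rw [h2 hk]; push_cast; linarith
  | tail _ hs ih => exact ConnectedInside.trans ih (hstep _ _ hs)

/-- Two fixed points lie in a box around the origin at every large enough scale, and local
uniqueness there fails with arbitrarily small probability; the pairs of points are countable. -/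
theorem ae_connected (hd : 2 ≤ d) {ε : unitInterval} (hε : 0 < ε) (hX : X ⊆ latticeEdges d)
    (hperc : EverywherePercolating X) :
    ∀ᵐ ω ∂(setBernoulli (latticeEdges d) ε), (graph (X ∪ ω)).Connected := by
  have h : ∀ x y : Fin d → ℤ, ∀ᵐ ω ∂(setBernoulli (latticeEdges d) ε),
      (graph (X ∪ ω)).Reachable x y := by
    intro x y
    have hle : ∀ δ : ℝ, 0 < δ → (setBernoulli (latticeEdges d) ε).real
        {ω | ¬ (graph (X ∪ ω)).Reachable x y} ≤ 0 + δ := by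
      intro δ hδ
      obtain ⟨n, hn, -, hloc⟩ := exists_scale_locallyConnected hd hε hδ (max (rad 0 x) (rad 0 y))
      rw [zero_add]
      refine (measureReal_mono (fun ω hω => ?_) (measure_ne_top _ _)).trans (hloc X hX hperc 0)
      refine fun hl => hω (hl x ?_ y ?_).reachable
      · exact mem_box_iff.2 ((le_max_left _ _).trans hn)
      · exact mem_box_iff.2 ((le_max_right _ _).trans hn)
    have h0 := le_antisymm (le_of_forall_pos_le_add hle) measureReal_nonneg
    rw [measureReal_eq_zero_iff (measure_ne_top _ _)] at h0
    exact h0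
  filter_upwards [ae_all_iff.2 fun x => ae_all_iff.2 (h x)] with ω hω
  exact ⟨hω⟩

/-- A slightly thinned version of `X ∪ ω` percolates in a thick quarter plane. -/
theorem exists_scale_ae_ae_renormalize_mem (hd : 2 ≤ d) {ε : unitInterval} (hε : 0 < ε) :
    ∃ n : ℕ, 1 ≤ n ∧ ∃ q : unitInterval, q < 1 ∧ ∀ X : Set (Sym2 (Fin d → ℤ)),
      X ⊆ latticeEdges d → EverywherePercolating X →
      ∀ᵐ ω ∂(setBernoulli (latticeEdges d) ε), ∀ᵐ ζ ∂(setBernoulli (latticeEdges d) q),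
        renormalize n ((X ∪ ω) ∩ ζ) ∈ unblockedEvent d := by
  let p : unitInterval := ⟨15 / 16, by norm_num, by norm_num⟩
  obtain ⟨n, hn, q, hq, hdom⟩ := exists_scale_stochasticallyDominates hd hε (p := p)
    (Subtype.coe_lt_coe.1 (show (15 / 16 : ℝ) < 1 by norm_num))
  refine ⟨n, hn, q, hq, fun X hX hperc => ?_⟩
  have h := hdom X hX hperc (unblockedEvent d) (measurableSet_unblockedEvent d)
    (isUpperSet_unblockedEvent d)
  rw [setBernoulli_unblockedEvent hd rfl] at h
  have hm := measurable_renormalize X n (measurableSet_unblockedEvent d)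
  -- Fubini: for almost every fixed `ω` the statement holds for almost every thinning, as needed to
  -- bound the critical parameter of the realized graph.
  exact Measure.ae_ae_of_ae_prod ((prob_compl_eq_zero_iff hm).2 (le_antisymm prob_le_one h))

theorem measurable_renormalize_self (n : ℕ) :
    Measurable fun Y : Set (Sym2 (Fin d → ℤ)) => renormalize n Y := by
  have h := (measurable_renormalize (Set.univ : Set (Sym2 (Fin d → ℤ))) n).comp
    (measurable_id.prodMk measurable_id)
  simpa [Function.comp_def] using h

/-- The parameter `q` itself is admissible in the infimum, because `q`-percolation on `Y` has the
law of `Y ∩ ζ`. -/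
theorem criticalParameter_lt_one (hd : 2 ≤ d) {n : ℕ} (hn : 1 ≤ n) {q : unitInterval} (hq : q < 1)
    (hY : Y ⊆ latticeEdges d)
    (h : ∀ᵐ ζ ∂(setBernoulli (latticeEdges d) q), renormalize n (Y ∩ ζ) ∈ unblockedEvent d) :
    criticalParameter Y < 1 := by
  refine lt_of_le_of_lt (sInf_le ?_) hq
  have hm : Measurable (fun ω : Set (Sym2 (Fin d → ℤ)) => Y ∩ ω) := by
    refine measurable_set_iff.2 fun e => ?_
    by_cases he : e ∈ Y
    · simpa [he] using measurable_set_mem e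
    · simp [he]
  have hae : ∀ᵐ η ∂(setBernoulli Y q), renormalize n η ∈ unblockedEvent d := by
    rw [← setBernoulli_map_inter q hY, ae_map_iff hm.aemeasurable
      (measurable_renormalize_self n (measurableSet_unblockedEvent d))]
    exact h
  exact hae.mono fun η hη =>
    (percolatesIn_of_renormalize_mem hd hn hη).mono le_rfl (Set.subset_univ _)

end Percolation

end LatticePerc

theorem theorem1p1 (d : ℕ) (hd : 2 ≤ d) (ε : unitInterval) (hε : 0 < ε) :
    ∃ L : ℕ, ∀ X : Set (Sym2 (Fin d → ℤ)), X ⊆ latticeEdges d → EverywherePercolating X →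
      (∀ᵐ ω ∂(bernoulliPerc (latticeEdges d) ε), (graph (X ∪ ω)).Connected) ∧
      (∀ᵐ ω ∂(bernoulliPerc (latticeEdges d) ε), criticalParameter (X ∪ ω) < 1) ∧
      (∀ᵐ ω ∂(bernoulliPerc (latticeEdges d) ε), PercolatesIn (X ∪ ω) (halfSpace d)) ∧
      (∀ᵐ ω ∂(bernoulliPerc (latticeEdges d) ε), PercolatesIn (X ∪ ω) (slab d L)) ∧
      (∀ p : unitInterval, p < 1 → ∃ n : ℕ, 1 ≤ n ∧
        StochasticallyDominates (bernoulliPerc (latticeEdges d) ε)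
          (fun ω => renormalize n (X ∪ ω)) (bernoulliPerc (latticeEdges d) p)) := by
  obtain ⟨n, hn, q, hq, hae⟩ := exists_scale_ae_ae_renormalize_mem hd hε
  -- The scale `n`, and with it the thickness of the slab, was fixed before `X`.
  refine ⟨4 * n, fun X hX hperc => ?_⟩
  have hquarter : ∀ᵐ ω ∂(bernoulliPerc (latticeEdges d) ε),
      PercolatesIn (X ∪ ω) (quarterSlab d (4 * n)) := by
    filter_upwards [hae X hX hperc] with ω hω
    -- One good thinning suffices, since putting the deleted edges back preserves percolation.
    obtain ⟨ζ, hζ⟩ := hω.exists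
    exact (percolatesIn_of_renormalize_mem hd hn hζ).mono Set.inter_subset_left le_rfl
  refine ⟨ae_connected hd hε hX hperc, ?_, ?_, ?_, fun p hp => ?_⟩
  · filter_upwards [hae X hX hperc, setBernoulli_ae_subset] with ω hω hsub
    exact criticalParameter_lt_one hd hn hq (Set.union_subset hX hsub) hω
  · exact hquarter.mono fun ω hω => hω.mono le_rfl fun z hz i _ => (hz i).1
  · exact hquarter.mono fun ω hω => hω.mono le_rfl fun z hz i hi => ⟨(hz i).1, (hz i).2 hi⟩
  · obtain ⟨k, hk, q', -, hdom⟩ := exists_scale_stochasticallyDominates hd hε hp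
    refine ⟨k, hk, fun A hA hup => (hdom X hX hperc A hA hup).trans ?_⟩
    -- Dropping the thinning only enlarges the renormalized configuration, and the resulting event
    -- depends on the first factor alone.
    calc _ ≤ ((setBernoulli (latticeEdges d) ε).prod (setBernoulli (latticeEdges d) q'))
          (((fun ω => renormalize k (X ∪ ω)) ⁻¹' A) ×ˢ Set.univ) :=
          measure_mono fun ω hω =>
            ⟨hup (renormalize_mono k Set.inter_subset_left) hω, Set.mem_univ _⟩
      _ = _ := by rw [Measure.prod_prod, measure_univ, mul_one]
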